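/- **Setting.** Let $H$ be a real separable Hilbert space and $A$ a self-adjoint positive operator in $H$ with an orthonormal eigenbasis $\{e_k\}_{k\ge1}$, $Ae_k=\lambda_ke_k$, $0<\lambda_1\le\lambda_2\le\dots$, $\lambda_k\to\infty$. For $s\ge 0$ let $F_s=D(A^s)$ with $(x,y)_s=(A^sx,A^sy)$, so $F_0=H$; for $s<0$, $F_s$ is the space of formal series $\sum c_ke_k$ with $\sum c_k^2\lambda_k^{2s}<\infty$, and powers of $A$ act coefficientwise. Let $\omega\in[0,1)$, $\nu>0$, $p\in H$. Let $k_1,k_2$ be continuous, (strictly) decreasing functions on $[0,\infty)$ with $\lim_{s\to\infty} k_1(s)=\beta>0$ and $\lim_{s\to\infty} k_2(s)=0$, such that $\mu_1=-k_1'$ and $\mu_2=-(1-\omega)k_2'$ satisfy, for $i=1,2$, $$\mu_i\in C^1(0,\infty)\cap L^1(0,\infty)\cap C[0,\infty),\qquad \mu_i\ge 0,\qquad \mu_i'+\delta_i\mu_i\le 0\ \text{ with some }\delta_i>0 .$$ Let $M\in C^2(0,\infty)$ be integrable near $0$ with $\int_0^zM(\xi)\,d\xi\ge -az-b$ for all $z\ge0$,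 for some $a\in(0,\lambda_1)$ and $b\in\mathbb R$. Let $L^2_{\mu}(\mathbb R_+;E)$ be the space of (classes of) measurable functions on $(0,\infty)$ with $\int_0^\infty\mu(s)\|\xi(s)\|_E^2\,ds<\infty$, and $$\mathcal H=F_1\times F_0\times F_0\times L^2_{\mu_1}(\mathbb R_+;F_1)\times L^2_{\mu_2}(\mathbb R_+;F_{1/2}).$$ Let $\overline T=-\partial_s$ on $L^2_{\mu_1}(\mathbb R_+;F_1)$ and $T=-\partial_s$ on $L^2_{\mu_2}(\mathbb R_+;F_{1/2})$ (distributional derivative), each with domain the functions that lie in the space together with their derivative and vanish at $s=0$. For $U=(u,w,v,\overline\eta,\eta)$ put $$\mathcal LU=\Big(w,\ -\beta A^2u-\int_0^\infty\mu_1(s)A^2\overline\eta(s)\,ds+\nu Av,\ -\omega Av-\int_0^\infty\mu_2(s)A\eta(s)\,ds-\nu Aw,\ \overline T\,\overline\eta+w,\ T\eta+v\Big),$$ where $D(\mathcal L)$ consists of the $U\in\mathcal H$ with $w\in F_1$, $v\in F_{1/2}$, $\overline\eta\in D(\overline T)$, $\eta\in D(T)$ and second and third components of $\mathcal LU$ in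 $F_0$. Put $$f(U)=\big(0,\,-M(\|A^{1/2}u\|^2)Au+p,\,0,\,0,\,0\big),$$ and, for $W\in\mathcal H$ with first component $w\in F_1$, $$f'(u)W=\big(0,\,-M'(\|A^{1/2}u\|^2)(Au,w)Au-M(\|A^{1/2}u\|^2)Aw,\,0,\,0,\,0\big).$$ A (mild) solution on $[0,\tau]$ of $\dot U=\mathcal LU+g(t,U)$ is a function $U\in C([0,\tau];\mathcal H)$ such that $t\mapsto g(t,U(t))$ is integrable on $[0,\tau]$ and $$U(t)=e^{t\mathcal L}U(0)+\int_0^te^{(t-r)\mathcal L}g(r,U(r))\,dr,\qquad t\in[0,\tau],$$ where $e^{t\mathcal L}$ is the strongly continuous semigroup on $\mathcal H$ with infinitesimal generator $\mathcal L$. **Proposition (backward uniqueness).** Let $\tau>0$. 1. Let $U^1,U^2$ be two solutions on $[0,\tau]$ of $\dot U=\mathcal LU+f(U)$. If $U^1(\tau)=U^2(\tau)$, then $U^1(t)=U^2(t)$ for every $t\in[0,\tau]$. 2. Let $u\in C([0,\tau];F_1)$ and let $W$ be a solution on $[0,\tau]$ of the linear non-autonomous equation $\dot W=\mathcal LW+f'(u(t))W$.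 If $W(\tau)=0$, then $W(t)=0$ for every $t\in[0,\tau]$. -/

import Mathlib

open MeasureTheory Set Filter Topology
open scoped NNReal ENNReal

noncomputable section

/-- A self-adjoint positive operator `A` with an eigenbasis: `A e_k = λ_k e_k`,
`0 < λ_0 ≤ λ_1 ≤ …`, `λ_k → ∞`. As `(e_k)` is an orthonormal basis of `H`, the operator is
determined by these data. -/
structure EigenOp (H : Type*) [NormedAddCommGroup H] [InnerProductSpace ℝ H] where
  /-- the orthonormal basis of eigenvectors -/
  e : HilbertBasis ℕ ℝ H
  /-- the eigenvalues -/
  lam : ℕ → ℝ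
  lam_pos : 0 < lam 0
  lam_mono : Monotone lam
  lam_tendsto : Tendsto lam atTop atTop

namespace EigenOp

variable {H : Type*} [NormedAddCommGroup H] [InnerProductSpace ℝ H] (A : EigenOp H)

theorem pos (k : ℕ) : 0 < A.lam k := lt_of_lt_of_le A.lam_pos (A.lam_mono (Nat.zero_le k))

/-- The `k`-th coefficient `(x, e_k)`. -/
def coef (x : H) (k : ℕ) : ℝ := inner ℝ (A.e k) x

theorem coef_eq (x : H) (k : ℕ) : A.coef x k = A.e.repr x k :=
  (A.e.repr_apply_apply x k).symm

theorem memlp_iff (c : ℕ → ℝ) : Memℓp c 2 ↔ Summable fun k => c k ^ 2 := by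
  rw [memℓp_gen_iff (by norm_num)]
  simp

/-- `D(A^s) = {x : ∑ λ_k^{2s} (x, e_k)² < ∞}`, as a subspace of `H`. -/
def dom (s : ℝ≥0) : Submodule ℝ H where
  carrier := {x | Summable fun k => A.lam k ^ (2 * (s : ℝ)) * A.coef x k ^ 2}
  zero_mem' := by simp [coef, summable_zero]
  add_mem' := by
    intro x y hx hy
    refine Summable.of_nonneg_of_le (fun k => ?_) (fun k => ?_) ((hx.mul_left 2).add (hy.mul_left 2))
    · exact mul_nonneg (Real.rpow_nonneg (A.pos k).le _) (sq_nonneg _)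
    · have h0 := Real.rpow_nonneg (A.pos k).le (2 * (s : ℝ))
      have h1 : A.coef (x + y) k = A.coef x k + A.coef y k := by simp [coef, inner_add_right]
      rw [h1]
      nlinarith [mul_nonneg h0 (sq_nonneg (A.coef x k - A.coef y k))]
  smul_mem' := by
    intro c x hx
    refine (hx.mul_left (c ^ 2)).congr fun k => ?_
    have h1 : A.coef (c • x) k = c * A.coef x k := by simp [coef, inner_smul_right]
    rw [h1]; ring

theorem mem_dom {s : ℝ≥0} {x : H} :
    x ∈ A.dom s ↔ Summable fun k => A.lam k ^ (2 * (s : ℝ)) * A.coef x k ^ 2 := Iff.rfl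

theorem dom_anti {s t : ℝ≥0} (h : s ≤ t) : A.dom t ≤ A.dom s := by
  intro x hx
  rw [mem_dom] at hx ⊢
  refine Summable.of_nonneg_of_le (fun k => ?_) (fun k => ?_)
    (hx.mul_left (A.lam 0 ^ (2 * (s : ℝ) - 2 * (t : ℝ))))
  · exact mul_nonneg (Real.rpow_nonneg (A.pos k).le _) (sq_nonneg _)
  · rw [← mul_assoc]
    refine mul_le_mul_of_nonneg_right ?_ (sq_nonneg _)
    have hst : (s : ℝ) ≤ t := h
    have h2 : A.lam k ^ (2 * (s : ℝ) - 2 * (t : ℝ)) ≤ A.lam 0 ^ (2 * (s : ℝ) - 2 * (t : ℝ)) :=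
      Real.rpow_le_rpow_of_nonpos A.lam_pos (A.lam_mono (Nat.zero_le k)) (by linarith)
    calc A.lam k ^ (2 * (s : ℝ))
        = A.lam k ^ (2 * (s : ℝ) - 2 * (t : ℝ)) * A.lam k ^ (2 * (t : ℝ)) := by
          rw [← Real.rpow_add (A.pos k)]; congr 1; ring
      _ ≤ _ := mul_le_mul_of_nonneg_right h2 (Real.rpow_nonneg (A.pos k).le _)

/-- The space `F_s = D(A^s)`. It is a type of its own because it carries the norm
`‖x‖_s = ‖A^s x‖`, not the norm of `H`. -/
def F (s : ℝ≥0) : Type _ := A.dom s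

instance (s : ℝ≥0) : AddCommGroup (A.F s) := inferInstanceAs (AddCommGroup (A.dom s))
instance (s : ℝ≥0) : Module ℝ (A.F s) := inferInstanceAs (Module ℝ (A.dom s))

/-- The inclusion `F_s ⊆ H`. -/
def val {s : ℝ≥0} : A.F s →ₗ[ℝ] H := (A.dom s).subtype

/-- The inclusion `F_t ⊆ F_s` for `s ≤ t`. -/
def incl {s t : ℝ≥0} (h : s ≤ t) : A.F t →ₗ[ℝ] A.F s := Submodule.inclusion (A.dom_anti h)

theorem val_mem {s : ℝ≥0} (x : A.F s) : A.val x ∈ A.dom s := Subtype.property x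

theorem exists_val {s : ℝ≥0} {x : H} (h : x ∈ A.dom s) : ∃ y : A.F s, A.val y = x := ⟨⟨x, h⟩, rfl⟩

theorem val_injective {s : ℝ≥0} : Function.Injective (A.val (s := s)) :=
  Subtype.val_injective

theorem memlp_pow {s : ℝ≥0} (x : A.F s) :
    Memℓp (fun k => A.lam k ^ (s : ℝ) * A.coef (A.val x) k) 2 := by
  rw [memlp_iff]
  refine (A.mem_dom.1 (A.val_mem x)).congr fun k => ?_
  rw [mul_pow, mul_comm 2 (s : ℝ), Real.rpow_mul (A.pos k).le]
  norm_num

/-- `A^s : F_s → H`, `A^s x = ∑ λ_k^s (x, e_k) e_k`. -/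
def pow (s : ℝ≥0) : A.F s →ₗ[ℝ] H where
  toFun x := A.e.repr.symm ⟨_, A.memlp_pow x⟩
  map_add' x y := by
    rw [← map_add]; congr 1; ext k
    change _ = A.lam k ^ (s : ℝ) * A.coef (A.val x) k + A.lam k ^ (s : ℝ) * A.coef (A.val y) k
    simp [coef, inner_add_right, mul_add]
  map_smul' c x := by
    rw [RingHom.id_apply, ← map_smul]; congr 1; ext k
    change _ = c * (A.lam k ^ (s : ℝ) * A.coef (A.val x) k)
    simp [coef, inner_smul_right, mul_left_comm]

theorem coef_pow {s : ℝ≥0} (x : A.F s) (k : ℕ) :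
    A.coef (A.pow s x) k = A.lam k ^ (s : ℝ) * A.coef (A.val x) k := by
  rw [coef_eq]; simp [pow]

theorem ext_coef {x y : H} (h : ∀ k, A.coef x k = A.coef y k) : x = y := by
  apply A.e.repr.injective
  ext k
  rw [← coef_eq, ← coef_eq, h]

theorem pow_injective (s : ℝ≥0) : Function.Injective (A.pow s) := by
  intro x y h
  apply A.val_injective
  apply A.ext_coef
  intro k
  have h1 := congrArg (fun z => A.coef z k) h
  simp only [coef_pow] at h1
  exact mul_left_cancel₀ (Real.rpow_pos_of_pos (A.pos k) _).ne' h1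

theorem pow_surjective (s : ℝ≥0) : Function.Surjective (A.pow s) := by
  intro y
  have hy : Summable fun k => A.coef y k ^ 2 := by
    rw [← memlp_iff]
    have h : A.coef y = fun k => A.e.repr y k := funext (A.coef_eq y)
    rw [h]
    exact lp.memℓp (A.e.repr y)
  have hm : Memℓp (fun k => A.lam k ^ (-(s : ℝ)) * A.coef y k) 2 := by
    rw [memlp_iff]
    refine Summable.of_nonneg_of_le (fun k => sq_nonneg _) (fun k => ?_)
      (hy.mul_left ((A.lam 0 ^ (-(s : ℝ))) ^ 2))
    rw [mul_pow]
    refine mul_le_mul_of_nonneg_right ?_ (sq_nonneg _)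
    exact pow_le_pow_left₀ (Real.rpow_nonneg (A.pos k).le _)
      (Real.rpow_le_rpow_of_nonpos A.lam_pos (A.lam_mono (Nat.zero_le k)) (by simp)) 2
  have hc : ∀ k, A.coef (A.e.repr.symm ⟨_, hm⟩) k = A.lam k ^ (-(s : ℝ)) * A.coef y k := by
    intro k; rw [coef_eq]; simp
  have hcancel : ∀ k, A.lam k ^ (s : ℝ) * (A.lam k ^ (-(s : ℝ)) * A.coef y k) = A.coef y k := by
    intro k
    rw [← mul_assoc, ← Real.rpow_add (A.pos k)]; simp
  have hd : A.e.repr.symm ⟨_, hm⟩ ∈ A.dom s := by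
    rw [mem_dom]
    refine hy.congr fun k => ?_
    rw [hc, mul_comm 2 (s : ℝ), Real.rpow_mul (A.pos k).le]
    conv_lhs => rw [← hcancel k]
    rw [mul_pow]; norm_num
  obtain ⟨x, hx⟩ := A.exists_val hd
  refine ⟨x, A.ext_coef fun k => ?_⟩
  rw [coef_pow, hx, hc, hcancel]

instance (s : ℝ≥0) : NormedAddCommGroup (A.F s) :=
  NormedAddCommGroup.induced (A.F s) H (A.pow s) (A.pow_injective s)

theorem norm_eq {s : ℝ≥0} (x : A.F s) : ‖x‖ = ‖A.pow s x‖ := rfl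

/-- The inner product `(x, y)_s = (A^s x, A^s y)`. -/
instance (s : ℝ≥0) : InnerProductSpace ℝ (A.F s) where
  norm_smul_le c x := by rw [norm_eq, norm_eq, map_smul, norm_smul]
  inner x y := inner ℝ (A.pow s x) (A.pow s y)
  norm_sq_eq_re_inner x := by simp [norm_eq]
  conj_inner_symm x y := by simp [real_inner_comm]
  add_left x y z := by simp [inner_add_left]
  smul_left x y c := by simp [inner_smul_left]

instance [CompleteSpace H] (s : ℝ≥0) : CompleteSpace (A.F s) :=
  ((AddMonoidHomClass.isometry_of_norm (A.pow s)
    fun x => (A.norm_eq x).symm).isUniformInducing.completeSpace_congr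
    (A.pow_surjective s)).2 inferInstance

end EigenOp

/-! ### Kernels and memory spaces -/

/-- `k` is a decreasing memory kernel on `[0, ∞)` and `μ = -c k'`, where
`μ ∈ C¹(0,∞) ∩ L¹(0,∞) ∩ C[0,∞)`, `μ ≥ 0` and `μ' + δ μ ≤ 0`. -/
structure IsMemoryKernel (c : ℝ) (k μ : ℝ → ℝ) (δ : ℝ) : Prop where
  strictAnti : StrictAntiOn k (Ici 0)
  kernel_continuousOn : ContinuousOn k (Ici 0)
  hasDerivAt : ∀ s > 0, HasDerivAt (fun s => c * k s) (-μ s) s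
  contDiffOn : ContDiffOn ℝ 1 μ (Ioi 0)
  integrableOn : IntegrableOn μ (Ioi 0)
  continuousOn : ContinuousOn μ (Ici 0)
  nonneg : ∀ s > 0, 0 ≤ μ s
  delta_pos : 0 < δ
  decay : ∀ s > 0, deriv μ s + δ * μ s ≤ 0

/-- The measure `μ(s) ds` on `(0, ∞)`. -/
def memMeasure (μ : ℝ → ℝ) : Measure ℝ :=
  (volume.restrict (Ioi 0)).withDensity fun s => ENNReal.ofReal (μ s)

/-- The weighted space `L²_μ(0,∞; E)`. -/
abbrev Mem (μ : ℝ → ℝ) (E : Type*) [NormedAddCommGroup E] : Type _ := Lp E 2 (memMeasure μ)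

/-- `g` is the distributional derivative of `η` on `(0, ∞)`. -/
def IsWeakDeriv {E : Type*} [NormedAddCommGroup E] [NormedSpace ℝ E] (η g : ℝ → E) : Prop :=
  ∀ φ : ℝ → ℝ, ContDiff ℝ ((⊤ : ℕ∞) : WithTop ℕ∞) φ → HasCompactSupport φ → tsupport φ ⊆ Ioi 0 →
    ∫ s in Ioi 0, deriv φ s • η s = -∫ s in Ioi 0, φ s • g s

/-- `η(0) = 0`, for the representative of `η` that is continuous on `[0, ∞)`. -/
def VanishesAtZero {E : Type*} [NormedAddCommGroup E] (η : ℝ → E) : Prop :=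
  ∃ η' : ℝ → E, ContinuousOn η' (Ici 0) ∧ η' 0 = 0 ∧ η =ᵐ[volume.restrict (Ioi 0)] η'

/-- `η` lies in the domain of the translation generator `T = -∂_s` on `L²_μ(0,∞; E)` and
`T η = ζ`. -/
def MemGraph {E : Type*} [NormedAddCommGroup E] [NormedSpace ℝ E] {μ : ℝ → ℝ}
    (η ζ : Mem μ E) : Prop :=
  IsWeakDeriv η (fun s => -ζ s) ∧ VanishesAtZero η

/-! ### The evolution problem -/

section Problem

variable {H : Type*} [NormedAddCommGroup H] [InnerProductSpace ℝ H]

/-- The phase space `F_1 × F_0 × F_0 × L²_{μ₁}(0,∞; F_1) × L²_{μ₂}(0,∞; F_{1/2})`, with elements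
`(u, w, v, ηb, η)`. (The product carries the maximum norm, which is equivalent to the Hilbert
norm.) -/
abbrev Phase (A : EigenOp H) (μ₁ μ₂ : ℝ → ℝ) : Type _ :=
  A.F 1 × H × H × Mem μ₁ (A.F 1) × Mem μ₂ (A.F (1 / 2))

/-- The graph of the linear operator `𝓛`: `LinGraph β ω ν U U'` says that `U ∈ D(𝓛)` and
`𝓛 U = U'`. With `U = (u, w, v, ηb, η)` and `U' = (u', w', v', ηb', η')` this means

* `w ∈ F_1` and `u' = w`;
* `w' = -β A² u - ∫ μ₁(s) A² ηb(s) ds + ν A v`, the series on the right being in `F_0`;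
* `v ∈ F_{1/2}` and `v' = -ω A v - ∫ μ₂(s) A η(s) ds - ν A w`, the series on the right being
  in `F_0`;
* `ηb ∈ D(Tb)` and `ηb' = Tb ηb + w`;
* `η ∈ D(T)` and `η' = T η + v`.

The terms of the second and the third equation may lie in `F_s` with `s < 0` only, that is, they
are series `∑ c_k e_k`; the equations are written through the coefficients `c_k`. -/
def LinGraph {A : EigenOp H} {μ₁ μ₂ : ℝ → ℝ} (β ω ν : ℝ) :
    Phase A μ₁ μ₂ → Phase A μ₁ μ₂ → Prop :=
  fun ⟨u, w, v, ηb, η⟩ ⟨u', w', v', ηb', η'⟩ =>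
    A.val u' = w ∧
    (∀ k, A.coef w' k = -(β * (A.lam k ^ 2 * A.coef (A.val u) k))
      - (∫ s in Ioi 0, μ₁ s * (A.lam k ^ 2 * A.coef (A.val (ηb s)) k))
      + ν * (A.lam k * A.coef v k)) ∧
    (∀ k, A.coef v' k = -(ω * (A.lam k * A.coef v k))
      - (∫ s in Ioi 0, μ₂ s * (A.lam k * A.coef (A.val (η s)) k))
      - ν * (A.lam k * A.coef w k)) ∧
    (∃ ζ : Mem μ₁ (A.F 1), MemGraph ηb ζ ∧ ηb' =ᵐ[memMeasure μ₁] fun s => ζ s + u') ∧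
    (∃ v₁ : A.F (1 / 2), A.val v₁ = v ∧
      ∃ ζ : Mem μ₂ (A.F (1 / 2)), MemGraph η ζ ∧ η' =ᵐ[memMeasure μ₂] fun s => ζ s + v₁)

/-- `‖A^{1/2} u‖²` for `u ∈ F_1`. -/
def energyHalf (A : EigenOp H) (u : A.F 1) : ℝ :=
  ‖A.pow (1 / 2) (A.incl (show (1 / 2 : ℝ≥0) ≤ 1 from half_le_self zero_le_one) u)‖ ^ 2

/-- The nonlinearity `f(U) = (0, -M(‖A^{1/2}u‖²) A u + p, 0, 0, 0)`. -/
def force {A : EigenOp H} {μ₁ μ₂ : ℝ → ℝ} (M : ℝ → ℝ) (p : H) (U : Phase A μ₁ μ₂) :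
    Phase A μ₁ μ₂ :=
  (0, -(M (energyHalf A U.1) • A.pow 1 U.1) + p, 0, 0, 0)

/-- The linearization of `f` at a state with first component `u`: with `w` the first component of
`W`, it is `(0, -M'(‖A^{1/2}u‖²) (A u, w) A u - M(‖A^{1/2}u‖²) A w, 0, 0, 0)`. -/
def forceDeriv {A : EigenOp H} {μ₁ μ₂ : ℝ → ℝ} (M : ℝ → ℝ) (u : A.F 1) (W : Phase A μ₁ μ₂) :
    Phase A μ₁ μ₂ :=
  (0, -((deriv M (energyHalf A u) * inner ℝ (A.pow 1 u) (A.val W.1)) • A.pow 1 u)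
    - M (energyHalf A u) • A.pow 1 W.1, 0, 0, 0)

/-- The conditions on `M`: `M ∈ C²(0,∞)` and
`∫_0^z M(ξ) dξ ≥ -a z - b` for all `z ≥ 0`, with some `a ∈ (0, lam₁)` and `b ∈ ℝ`. -/
structure IsAdmissibleM (lam₁ : ℝ) (M : ℝ → ℝ) : Prop where
  contDiffOn : ContDiffOn ℝ 2 M (Ioi 0)
  intervalIntegrable : ∀ z ≥ 0, IntervalIntegrable M volume 0 z
  lower_bound : ∃ a ∈ Ioo 0 lam₁, ∃ b : ℝ, ∀ z ≥ 0, -a * z - b ≤ ∫ ξ in (0 : ℝ)..z, M ξ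

end Problem

/-! ### Semigroups and mild solutions -/

section Mild

variable {X : Type*} [NormedAddCommGroup X] [NormedSpace ℝ X]

/-- `(S t)_{t ≥ 0}` is a strongly continuous semigroup of bounded operators on `X`. -/
structure IsC0Semigroup (S : ℝ → X →L[ℝ] X) : Prop where
  zero : S 0 = ContinuousLinearMap.id ℝ X
  add : ∀ s ≥ 0, ∀ t ≥ 0, S (s + t) = (S s).comp (S t)
  tendsto : ∀ x, Tendsto (fun t => S t x) (𝓝[>] 0) (𝓝 x)

/-- The operator with graph `L` is the infinitesimal generator of `S`. -/
def Generates (L : X → X → Prop) (S : ℝ → X →L[ℝ] X) : Prop :=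
  ∀ x y, L x y ↔ Tendsto (fun t : ℝ => t⁻¹ • (S t x - x)) (𝓝[>] 0) (𝓝 y)

/-- `U ∈ C([0,T]; X)` is a mild solution of `U' = L U + g(t, U)` on `[0, T]`:
`U(t) = e^{tL} U(0) + ∫_0^t e^{(t-τ)L} g(τ, U(τ)) dτ`, where `e^{tL}` is the strongly continuous
semigroup generated by `L`. -/
def IsMildSolution (L : X → X → Prop) (g : ℝ → X → X) (T : ℝ) (U : ℝ → X) : Prop :=
  ∃ S : ℝ → X →L[ℝ] X, IsC0Semigroup S ∧ Generates L S ∧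
    ContinuousOn U (Icc 0 T) ∧
    IntegrableOn (fun τ => g τ (U τ)) (Icc 0 T) ∧
    ∀ t ∈ Icc 0 T, U t = S t (U 0) + ∫ τ in (0 : ℝ)..t, S (t - τ) (g τ (U τ))

end Mild

end

/-! The memory variables already determine everything; the momentum equations are never needed. Let
`D` be the difference of two solutions, or the linearized solution, with `D T = 0`. The forcing
enters only the velocity component, so the other equations are linear and unforced: `u_t = w`, `ηb_t
+ ηb_s = w`, `η_t + η_s = v`. Hence `y = ηb - u` satisfies `y_t + y_s = 0`. The characteristic
through `(t, s)` reaches the terminal time at `(T, s + T - t)`, still in the half line, where `y =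
0`. Thus `y = 0` everywhere, so `ηb(t, s) = u(t)` for all `s`, and the boundary value `ηb(t, 0) = 0`
gives `u = 0` and `ηb = 0`; then `w = u_t = 0`. The same argument with the primitive of `v` in place
of `u` gives `η = 0` and `v = 0`.

Mild solutions need not be differentiable, so the argument runs on time integrals.
`IsMildSolution.graph_integral` puts them in the domain of the generator, and
`IsWeakDeriv.ae_eq_primitive` turns the weak memory equation into an identity between primitives.
`transport_eq_zero_of_continuous` carries out the characteristics argument for integrated
quantities, `memory_eq_zero` transfers it to the weighted space, and `phase_eq_zero` assembles the
components. Strict decrease of the kernels makes the weights positive on all of `(0, ∞)`, so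
vanishing in the weighted space means vanishing almost everywhere. -/

noncomputable section

/-! ### Strongly continuous semigroups and time integrals of mild solutions. -/

section Semigroup

variable {X : Type*} [NormedAddCommGroup X] [NormedSpace ℝ X]

theorem IsC0Semigroup.tendsto_abs {S : ℝ → X →L[ℝ] X} (hS : IsC0Semigroup S) (x : X) :
    Tendsto (fun t => S |t| x) (𝓝 0) (𝓝 x) := by
  have h1 : Tendsto (fun t => S t x) (𝓝[≥] 0) (𝓝 x) := by
    rw [← Ioi_insert, nhdsWithin_insert, tendsto_sup]
    refine ⟨?_, hS.tendsto x⟩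
    rw [tendsto_pure_left]
    intro s hs
    simpa [hS.zero] using mem_of_mem_nhds hs
  refine h1.comp ?_
  rw [tendsto_nhdsWithin_iff]
  refine ⟨?_, Eventually.of_forall fun t => abs_nonneg t⟩
  simpa using (continuous_abs (G := ℝ)).tendsto 0

/-- If the norms were unbounded near zero, there would be `t n → 0` with `‖S (t n)‖ > n`; but each
orbit `S (t n) x` converges, which contradicts Banach–Steinhaus. -/
theorem IsC0Semigroup.exists_bound_near_zero [CompleteSpace X] {S : ℝ → X →L[ℝ] X}
    (hS : IsC0Semigroup S) : ∃ δ > 0, ∃ C, 0 ≤ C ∧ ∀ t ∈ Icc 0 δ, ‖S t‖ ≤ C := by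
  by_contra! hcon
  have h (n : ℕ) : ∃ t ∈ Icc (0 : ℝ) (1 / ((n : ℝ) + 1)), (n : ℝ) < ‖S t‖ :=
    hcon _ Nat.one_div_pos_of_nat n n.cast_nonneg
  choose t ht hlt using h
  have ht0 : Tendsto t atTop (𝓝 0) :=
    squeeze_zero (fun n => (ht n).1) (fun n => (ht n).2) tendsto_one_div_add_atTop_nhds_zero_nat
  obtain ⟨C, hC⟩ := banach_steinhaus (g := fun n => S (t n)) fun x => by
    have h1 := ((hS.tendsto_abs x).comp ht0).norm.bddAbove_range
    obtain ⟨C, hC⟩ := h1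
    refine ⟨C, fun n => ?_⟩
    have := hC ⟨n, rfl⟩
    simpa [abs_of_nonneg (ht n).1] using this
  obtain ⟨n, hn⟩ := exists_nat_gt C
  exact absurd (hC n) (not_le.2 (hn.trans (hlt n)))

theorem IsC0Semigroup.exists_bound [CompleteSpace X] {S : ℝ → X →L[ℝ] X}
    (hS : IsC0Semigroup S) (R : ℝ) : ∃ C, 0 ≤ C ∧ ∀ t ∈ Icc 0 R, ‖S t‖ ≤ C := by
  obtain ⟨δ, hδ, C₀, hC₀, hb⟩ := hS.exists_bound_near_zero
  have key (n : ℕ) : ∃ C, 0 ≤ C ∧ ∀ t ∈ Icc 0 (n * δ), ‖S t‖ ≤ C := by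
    induction n with
    | zero =>
      refine ⟨C₀, hC₀, fun t ht => hb t ⟨ht.1, ht.2.trans ?_⟩⟩
      simpa using hδ.le
    | succ n ih =>
      obtain ⟨C, hC, h⟩ := ih
      refine ⟨C * C₀, mul_nonneg hC hC₀, fun t ht => ?_⟩
      have h1 : 0 ≤ min t δ := le_min ht.1 hδ.le
      have h2 : 0 ≤ t - min t δ := sub_nonneg.2 (min_le_left _ _)
      have h3 : t - min t δ ≤ n * δ := by
        have h4 := ht.2
        push_cast at h4
        rcases le_total t δ with h | h
        · rw [min_eq_left h]; simp; positivity
        · rw [min_eq_right h]; linarith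
      calc ‖S t‖ = ‖(S (t - min t δ)).comp (S (min t δ))‖ := by
            rw [← hS.add _ h2 _ h1]; congr 2; ring
        _ ≤ ‖S (t - min t δ)‖ * ‖S (min t δ)‖ := ContinuousLinearMap.opNorm_comp_le _ _
        _ ≤ C * C₀ := mul_le_mul (h _ ⟨h2, h3⟩) (hb _ ⟨h1, min_le_right _ _⟩) (norm_nonneg _) hC
  obtain ⟨n, hn⟩ := exists_nat_gt (R / δ)
  obtain ⟨C, hC, h⟩ := key n
  exact ⟨C, hC, fun t ht => h t ⟨ht.1, ht.2.trans ((div_lt_iff₀ hδ).1 hn).le⟩⟩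

theorem IsC0Semigroup.continuous_orbit [CompleteSpace X] {S : ℝ → X →L[ℝ] X}
    (hS : IsC0Semigroup S) (x : X) : Continuous fun t : ℝ => S (max t 0) x := by
  rw [continuous_iff_continuousAt]
  intro t₀
  obtain ⟨C, hC, hb⟩ := hS.exists_bound (max t₀ 0)
  -- The semigroup law factors out the operator at the smaller of the two times, which is at most
  -- `max t₀ 0`; one bound therefore serves both sides of `t₀`.
  have hdist (t : ℝ) : ‖S (max t 0) x - S (max t₀ 0) x‖
      ≤ C * ‖S |max t 0 - max t₀ 0| x - x‖ := by
    set p := max t 0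
    set q := max t₀ 0
    have hp : 0 ≤ p := le_max_right _ _
    have hq : 0 ≤ q := le_max_right _ _
    rcases le_total p q with h | h
    · have e : S q = (S p).comp (S (q - p)) := by
        rw [← hS.add _ hp _ (sub_nonneg.2 h)]; congr 1; ring
      rw [abs_sub_comm, abs_of_nonneg (sub_nonneg.2 h), norm_sub_rev, e,
        ContinuousLinearMap.comp_apply, ← map_sub]
      exact ((S p).le_opNorm _).trans
        (mul_le_mul_of_nonneg_right (hb p ⟨hp, h⟩) (norm_nonneg _))
    · have e : S p = (S q).comp (S (p - q)) := by
        rw [← hS.add _ hq _ (sub_nonneg.2 h)]; congr 1; ring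
      rw [abs_of_nonneg (sub_nonneg.2 h), e, ContinuousLinearMap.comp_apply, ← map_sub]
      exact ((S q).le_opNorm _).trans
        (mul_le_mul_of_nonneg_right (hb q ⟨hq, le_rfl⟩) (norm_nonneg _))
  have hlim : Tendsto (fun t : ℝ => C * ‖S |max t 0 - max t₀ 0| x - x‖) (𝓝 t₀) (𝓝 0) := by
    have h1 : Tendsto (fun t : ℝ => max t 0 - max t₀ 0) (𝓝 t₀) (𝓝 0) := by
      have : Continuous fun t : ℝ => max t 0 - max t₀ 0 := by fun_prop
      simpa using this.tendsto t₀
    have h2 := (((hS.tendsto_abs x).comp h1).sub_const x).norm.const_mul C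
    simpa using h2
  exact tendsto_iff_norm_sub_tendsto_zero.2 (squeeze_zero (fun _ => norm_nonneg _) hdist hlim)

theorem IsC0Semigroup.continuous_uncurry [CompleteSpace X] {S : ℝ → X →L[ℝ] X}
    (hS : IsC0Semigroup S) : Continuous fun q : ℝ × X => S (max q.1 0) q.2 := by
  rw [continuous_iff_continuousAt]
  rintro ⟨t₀, x₀⟩
  obtain ⟨C, hC, hb⟩ := hS.exists_bound (|t₀| + 1)
  have hev : ∀ᶠ q : ℝ × X in 𝓝 (t₀, x₀), ‖S (max q.1 0) q.2 - S (max t₀ 0) x₀‖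
      ≤ C * ‖q.2 - x₀‖ + ‖S (max q.1 0) x₀ - S (max t₀ 0) x₀‖ := by
    have h1 : ∀ᶠ q : ℝ × X in 𝓝 (t₀, x₀), q.1 < |t₀| + 1 :=
      continuous_fst.continuousAt.eventually_lt continuousAt_const
        (lt_of_le_of_lt (le_abs_self t₀) (lt_add_one _))
    filter_upwards [h1] with q hq
    have e : S (max q.1 0) q.2 - S (max t₀ 0) x₀
        = S (max q.1 0) (q.2 - x₀) + (S (max q.1 0) x₀ - S (max t₀ 0) x₀) := by
      rw [map_sub]; abel
    rw [e]
    refine (norm_add_le _ _).trans (add_le_add_left ?_ _)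
    refine ((S _).le_opNorm _).trans (mul_le_mul_of_nonneg_right (hb _ ?_) (norm_nonneg _))
    exact ⟨le_max_right _ _, max_le hq.le (by positivity)⟩
  have hlim : Tendsto (fun q : ℝ × X => C * ‖q.2 - x₀‖ + ‖S (max q.1 0) x₀ - S (max t₀ 0) x₀‖)
      (𝓝 (t₀, x₀)) (𝓝 0) := by
    have hc : Continuous fun q : ℝ × X =>
        C * ‖q.2 - x₀‖ + ‖S (max q.1 0) x₀ - S (max t₀ 0) x₀‖ := by
      have := (hS.continuous_orbit x₀).comp (continuous_fst (X := ℝ) (Y := X))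
      exact (continuous_const.mul (continuous_snd.sub continuous_const).norm).add
        (this.sub continuous_const).norm
    simpa using hc.tendsto (t₀, x₀)
  exact tendsto_iff_norm_sub_tendsto_zero.2
    (squeeze_zero' (Eventually.of_forall fun _ => norm_nonneg _) hev hlim)

/-- Averages of a continuous function over shrinking intervals. -/
theorem tendsto_inv_smul_integral {K : ℝ → ℝ → X}
    (hK : ContinuousAt (fun q : ℝ × ℝ => K q.1 q.2) (0, 0))
    (hi : ∀ᶠ h in 𝓝[>] (0 : ℝ), IntervalIntegrable (K h) volume 0 h) [CompleteSpace X] :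
    Tendsto (fun h : ℝ => h⁻¹ • ∫ σ in (0 : ℝ)..h, K h σ) (𝓝[>] 0) (𝓝 (K 0 0)) := by
  rw [Metric.tendsto_nhds]
  intro ε hε
  obtain ⟨r, hr, hb⟩ := Metric.continuousAt_iff.1 hK (ε / 2) (half_pos hε)
  have hI : Ioo 0 r ∈ 𝓝[>] (0 : ℝ) := Ioo_mem_nhdsGT hr
  filter_upwards [hI, hi] with h hh hint
  have e : h⁻¹ • (∫ σ in (0 : ℝ)..h, K h σ) - K 0 0
      = h⁻¹ • ∫ σ in (0 : ℝ)..h, (K h σ - K 0 0) := by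
    rw [intervalIntegral.integral_sub hint intervalIntegrable_const, smul_sub]
    simp [smul_smul, inv_mul_cancel₀ hh.1.ne']
  rw [dist_eq_norm, e, norm_smul, norm_inv, Real.norm_of_nonneg hh.1.le]
  have h2 : ‖∫ σ in (0 : ℝ)..h, (K h σ - K 0 0)‖ ≤ ε / 2 * |h - 0| := by
    refine intervalIntegral.norm_integral_le_of_norm_le_const fun σ hσ => ?_
    rw [uIoc_of_le hh.1.le] at hσ
    have h3 := hb (x := (h, σ)) (by
      rw [Prod.dist_eq, max_lt_iff]
      simp only [Real.dist_eq, sub_zero]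
      rw [abs_of_pos hh.1, abs_of_pos hσ.1]
      exact ⟨hh.2, hσ.2.trans_lt hh.2⟩)
    rw [dist_eq_norm] at h3
    exact h3.le
  rw [sub_zero, abs_of_pos hh.1] at h2
  calc h⁻¹ * ‖∫ σ in (0 : ℝ)..h, (K h σ - K 0 0)‖ ≤ h⁻¹ * (ε / 2 * h) :=
        mul_le_mul_of_nonneg_left h2 (inv_nonneg.2 hh.1.le)
    _ = ε / 2 := by field_simp [hh.1.ne']
    _ < ε := half_lt_self hε

/-- `L` is only a relation; its linearity comes from the difference quotients of `S`. -/
theorem Generates.sub {L : X → X → Prop} {S : ℝ → X →L[ℝ] X} (h : Generates L S) {x y x' y' : X}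
    (h₁ : L x y) (h₂ : L x' y') : L (x - x') (y - y') := by
  rw [h] at h₁ h₂ ⊢
  refine (h₁.sub h₂).congr fun t => ?_
  rw [← smul_sub, map_sub]; congr 1; abel

theorem IsC0Semigroup.integrable_comp [CompleteSpace X] {S : ℝ → X →L[ℝ] X}
    (hS : IsC0Semigroup S) {γ : ℝ → X} (hγ : Integrable γ) (c a b : ℝ) :
    IntervalIntegrable (fun r => S (max (c - r) 0) (γ r)) volume a b := by
  obtain ⟨C, hC, hb⟩ := hS.exists_bound (max (c - min a b) 0)
  rw [intervalIntegrable_iff]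
  refine Integrable.mono' (hγ.norm.const_mul C).integrableOn ?_ ?_
  · exact (hS.continuous_uncurry.comp_aestronglyMeasurable
      (((continuous_const.sub continuous_id).aestronglyMeasurable).prodMk
        hγ.aestronglyMeasurable)).restrict
  · refine (ae_restrict_iff' measurableSet_uIoc).2 (Eventually.of_forall fun r hr => ?_)
    refine ((S _).le_opNorm _).trans (mul_le_mul_of_nonneg_right (hb _ ?_) (norm_nonneg _))
    refine ⟨le_max_right _ _, max_le_max_right _ ?_⟩
    have : min a b < r := hr.1
    linarith

/-- This licenses Fubini in the double Duhamel integral. As `γ` is merely integrable, integrability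
of the sheared function `γ (q.1 + h - q.2)` is read off from the integrand of a convolution with an
indicator. -/
theorem IsC0Semigroup.integrable_prod [CompleteSpace X] {S : ℝ → X →L[ℝ] X}
    (hS : IsC0Semigroup S) {γ : ℝ → X} (hγ : Integrable γ) (h a : ℝ) :
    Integrable (fun q : ℝ × ℝ => S (max q.2 0) (γ (q.1 + h - q.2)))
      ((volume.restrict (Ioc 0 a)).prod (volume.restrict (Ioc 0 h))) := by
  obtain ⟨C, hC, hb⟩ := hS.exists_bound (max h 0)
  have h1 : Integrable (fun r => γ (r + h)) := hγ.comp_add_right h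
  have h0 : Integrable ((Ioc 0 h).indicator fun _ : ℝ => (1 : ℝ)) :=
    (integrable_indicator_iff measurableSet_Ioc).2 (integrableOn_const (by simp))
  have h2 := h0.convolution_integrand (ContinuousLinearMap.lsmul ℝ ℝ : ℝ →L[ℝ] X →L[ℝ] X) h1
  have h3 : Integrable (fun q : ℝ × ℝ => γ (q.1 + h - q.2))
      ((volume.restrict (Ioc 0 a)).prod (volume.restrict (Ioc 0 h))) := by
    rw [Measure.prod_restrict]
    refine (h2.integrableOn (s := Ioc 0 a ×ˢ Ioc 0 h)).congr ?_
    refine (ae_restrict_iff' (measurableSet_Ioc.prod measurableSet_Ioc)).2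
      (Eventually.of_forall fun q hq => ?_)
    simp only [indicator_of_mem hq.2, ContinuousLinearMap.lsmul_apply, one_smul]
    congr 1; ring
  refine Integrable.mono' (h3.norm.const_mul C) ?_ ?_
  · exact hS.continuous_uncurry.comp_aestronglyMeasurable
      (continuous_snd.aestronglyMeasurable.prodMk h3.aestronglyMeasurable)
  · rw [Measure.prod_restrict]
    refine (ae_restrict_iff' (measurableSet_Ioc.prod measurableSet_Ioc)).2
      (Eventually.of_forall fun q hq => ?_)
    refine ((S _).le_opNorm _).trans (mul_le_mul_of_nonneg_right (hb _ ?_) (norm_nonneg _))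
    exact ⟨le_max_right _ _, max_le_max_right _ hq.2.2⟩

/-- The time integral of a mild solution lies in the domain of the generator. -/
theorem IsMildSolution.graph_integral [CompleteSpace X] {L : X → X → Prop} {g : ℝ → X → X}
    {T : ℝ} {U : ℝ → X} (hU : IsMildSolution L g T U) {t : ℝ} (ht : t ∈ Icc 0 T) :
    L (∫ r in (0 : ℝ)..t, U r) (U t - U 0 - ∫ r in (0 : ℝ)..t, g r (U r)) := by
  obtain ⟨S, hS, hL, hc, hi, hm⟩ := hU
  rcases ht.1.eq_or_lt with rfl | ht0
  · rw [hL]; simp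
  have hT : 0 ≤ T := ht.1.trans ht.2
  -- Extension by zero makes all translates of the forcing integrable on the line.
  set γ : ℝ → X := (Icc 0 T).indicator fun r => g r (U r) with hγdef
  have hγ : Integrable γ := (integrable_indicator_iff measurableSet_Icc).2 hi
  have hγint (τ : ℝ) (hτ : τ ∈ Icc 0 T) :
      ∫ r in (0 : ℝ)..τ, g r (U r) = ∫ r in (0 : ℝ)..τ, γ r := by
    refine intervalIntegral.integral_congr fun r hr => ?_
    rw [uIcc_of_le hτ.1] at hr
    simp only [hγdef]
    rw [indicator_of_mem (show r ∈ Icc 0 T from ⟨hr.1, hr.2.trans hτ.2⟩)]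
  have hm' (τ : ℝ) (hτ : τ ∈ Icc 0 T) :
      U τ = S (max τ 0) (U 0) + ∫ r in (0 : ℝ)..τ, S (max (τ - r) 0) (γ r) := by
    rw [max_eq_left hτ.1]
    nth_rewrite 1 [hm τ hτ]
    congr 1
    refine intervalIntegral.integral_congr fun r hr => ?_
    rw [uIcc_of_le hτ.1] at hr
    have h1 : γ r = g r (U r) := by
      rw [hγdef, indicator_of_mem (show r ∈ Icc 0 T from ⟨hr.1, hr.2.trans hτ.2⟩)]
    simp only [h1, max_eq_left (sub_nonneg.2 hr.2)]
  -- a continuous extension of `U`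
  set V : ℝ → X := IccExtend hT ((Icc 0 T).domRestrict U) with hVdef
  have hV : Continuous V := (continuousOn_iff_continuous_domRestrict.1 hc).Icc_extend'
  have hVU (τ : ℝ) (hτ : τ ∈ Icc 0 T) : V τ = U τ := by
    rw [hVdef, IccExtend_of_mem _ _ hτ]; rfl
  set G : ℝ → X := fun x => ∫ r in (0 : ℝ)..x, γ r with hGdef
  have hG : Continuous G := intervalIntegral.continuous_primitive
    (fun a b => hγ.intervalIntegrable) 0
  have hadd (a b : ℝ) (ha : 0 ≤ a) (hb : 0 ≤ b) (x : X) :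
      S (max a 0) (S (max b 0) x) = S (max (a + b) 0) x := by
    rw [max_eq_left ha, max_eq_left hb, max_eq_left (add_nonneg ha hb), hS.add a ha b hb]; rfl
  have stepA (τ h : ℝ) (hτ : 0 ≤ τ) (hh : 0 ≤ h) (hle : τ + h ≤ T) :
      S (max h 0) (V τ) = V (τ + h) - ∫ σ in (0 : ℝ)..h, S (max σ 0) (γ (τ + h - σ)) := by
    have m1 : τ ∈ Icc 0 T := ⟨hτ, by linarith⟩
    have m2 : τ + h ∈ Icc 0 T := ⟨by linarith, hle⟩
    rw [hVU _ m1, hVU _ m2, hm' τ m1, hm' _ m2, map_add, hadd h τ hh hτ,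
      ← ContinuousLinearMap.intervalIntegral_comp_comm _ (hS.integrable_comp hγ _ _ _)]
    have e1 : ∫ r in (0 : ℝ)..τ, S (max h 0) (S (max (τ - r) 0) (γ r))
        = ∫ r in (0 : ℝ)..τ, S (max (τ + h - r) 0) (γ r) := by
      refine intervalIntegral.integral_congr fun r hr => ?_
      rw [uIcc_of_le hτ] at hr
      rw [hadd _ _ hh (sub_nonneg.2 hr.2)]
      congr 3; ring
    have e2 : ∫ σ in (0 : ℝ)..h, S (max σ 0) (γ (τ + h - σ))
        = ∫ r in τ..(τ + h), S (max (τ + h - r) 0) (γ r) := by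
      have := intervalIntegral.integral_comp_sub_left (a := (0 : ℝ)) (b := h)
        (fun r => S (max (τ + h - r) 0) (γ r)) (τ + h)
      simp only [sub_sub_cancel, sub_zero, add_sub_cancel_right] at this
      exact this
    rw [e1, e2, ← intervalIntegral.integral_add_adjacent_intervals
      (hS.integrable_comp hγ (τ + h) 0 τ) (hS.integrable_comp hγ (τ + h) τ (τ + h)), add_comm h τ]
    abel
  -- After the order of integration is exchanged, only the primitive `G` of the forcing remains. It
  -- is continuous, although `γ` need not be.
  have stepB (h : ℝ) (hh : 0 ≤ h) (hht : h ≤ t) :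
      ∫ τ in (0 : ℝ)..(t - h), ∫ σ in (0 : ℝ)..h, S (max σ 0) (γ (τ + h - σ))
        = ∫ σ in (0 : ℝ)..h, S (max σ 0) (G (t - σ) - G (h - σ)) := by
    simp only [intervalIntegral.integral_of_le hh,
      intervalIntegral.integral_of_le (sub_nonneg.2 hht)]
    rw [integral_integral_swap (hS.integrable_prod hγ h (t - h))]
    refine integral_congr_ae (Eventually.of_forall fun σ => ?_)
    simp only
    have h1 : Integrable (fun τ => γ (τ + h - σ)) := by
      simpa [add_sub_assoc] using hγ.comp_add_right (h - σ)
    rw [ContinuousLinearMap.integral_comp_comm _ h1.integrableOn,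
      ← intervalIntegral.integral_of_le (sub_nonneg.2 hht)]
    congr 1
    have e3 := intervalIntegral.integral_comp_add_right (a := (0 : ℝ)) (b := t - h)
        γ (h - σ)
    simp only [← add_sub_assoc, zero_add, sub_add_cancel] at e3
    rw [e3, hGdef]
    exact (intervalIntegral.integral_interval_sub_left hγ.intervalIntegrable
      hγ.intervalIntegrable).symm
  -- `K` is chosen so that `S h X - X = ∫ σ in 0..h, K h σ` for `X = ∫ r in 0..t, U r`. It is
  -- jointly continuous, so the difference quotient tends to `K 0 0`.
  set K : ℝ → ℝ → X := fun h σ =>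
    S (max h 0) (V (t - σ)) - V σ - S (max σ 0) (G (t - σ) - G (h - σ)) with hKdef
  have hSc {Y : Type} [TopologicalSpace Y] {f : Y → ℝ} {x : Y → X} (hf : Continuous f)
      (hx : Continuous x) : Continuous fun y => S (max (f y) 0) (x y) :=
    hS.continuous_uncurry.comp (hf.prodMk hx)
  have hK : Continuous fun q : ℝ × ℝ => K q.1 q.2 := by
    refine ((hSc continuous_fst ?_).sub (hV.comp continuous_snd)).sub (hSc continuous_snd ?_)
    all_goals fun_prop
  have hKint (h : ℝ) : IntervalIntegrable (K h) volume 0 h :=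
    (hK.comp (continuous_const.prodMk continuous_id)).intervalIntegrable 0 h
  have hlim := tendsto_inv_smul_integral (K := K) hK.continuousAt (Eventually.of_forall hKint)
  have hK0 : K 0 0 = U t - U 0 - ∫ r in (0 : ℝ)..t, g r (U r) := by
    simp only [hKdef, hγint t ht, max_self, hS.zero, sub_zero, hVU t ht, hVU 0 ⟨le_rfl, hT⟩,
      ContinuousLinearMap.id_apply, hGdef, intervalIntegral.integral_same]
  rw [hL, ← hK0]
  refine hlim.congr' ?_
  filter_upwards [Ioo_mem_nhdsGT ht0] with h hh
  congr 1
  have iV (a b : ℝ) : IntervalIntegrable V volume a b := hV.intervalIntegrable a b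
  have iSV (a b : ℝ) : IntervalIntegrable (fun τ => S (max h 0) (V τ)) volume a b :=
    (hSc continuous_const hV).intervalIntegrable a b
  have eX : ∫ r in (0 : ℝ)..t, U r = ∫ r in (0 : ℝ)..t, V r := by
    refine intervalIntegral.integral_congr fun r hr => ?_
    rw [uIcc_of_le ht.1] at hr
    exact (hVU r ⟨hr.1, hr.2.trans ht.2⟩).symm
  have e1 : ∫ σ in (0 : ℝ)..h, S (max h 0) (V (t - σ)) = ∫ τ in (t - h)..t, S (max h 0) (V τ) := by
    have := intervalIntegral.integral_comp_sub_left (a := (0 : ℝ)) (b := h)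
      (fun r => S (max h 0) (V r)) t
    simpa using this
  have cB : Continuous fun σ => S (max σ 0) (G (t - σ) - G (h - σ)) :=
    hSc continuous_id (by fun_prop)
  have cSV : Continuous fun σ => S (max h 0) (V (t - σ)) := hSc continuous_const (by fun_prop)
  -- `stepA` is applied only for `τ ≤ t - h`, since `τ + h` must stay in `[0, T]`; the piece over
  -- `[t - h, t]` goes into `K` as it is.
  have e2 : ∫ τ in (0 : ℝ)..(t - h), S (max h 0) (V τ)
      = (∫ τ in h..t, V τ) - ∫ σ in (0 : ℝ)..h, S (max σ 0) (G (t - σ) - G (h - σ)) := by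
    rw [← stepB h hh.1.le hh.2.le]
    have e3 : ∫ τ in (0 : ℝ)..(t - h), S (max h 0) (V τ) = ∫ τ in (0 : ℝ)..(t - h),
        (V (τ + h) - ∫ σ in (0 : ℝ)..h, S (max σ 0) (γ (τ + h - σ))) := by
      refine intervalIntegral.integral_congr fun r hr => ?_
      rw [uIcc_of_le (sub_nonneg.2 hh.2.le)] at hr
      exact stepA r h hr.1 hh.1.le (by linarith [hr.2, ht.2])
    rw [e3, intervalIntegral.integral_sub]
    · congr 1
      simp
    · exact (hV.comp (continuous_id.add continuous_const)).intervalIntegrable _ _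
    · rw [intervalIntegrable_iff, uIoc_of_le (sub_nonneg.2 hh.2.le)]
      simp only [intervalIntegral.integral_of_le hh.1.le]
      exact (hS.integrable_prod hγ h (t - h)).integral_prod_left
  have e4 : S h (∫ r in (0 : ℝ)..t, V r) = (∫ τ in (0 : ℝ)..(t - h), S (max h 0) (V τ))
      + ∫ τ in (t - h)..t, S (max h 0) (V τ) := by
    rw [intervalIntegral.integral_add_adjacent_intervals (iSV _ _) (iSV _ _),
      ContinuousLinearMap.intervalIntegral_comp_comm _ (iV _ _), max_eq_left hh.1.le]
  rw [eX, e4, e2, ← e1, ← intervalIntegral.integral_add_adjacent_intervals (iV 0 h) (iV h t)]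
  have iD : IntervalIntegrable (fun σ => S (max h 0) (V (t - σ)) - V σ) volume 0 h :=
    (cSV.sub hV).intervalIntegrable _ _
  simp only [hKdef]
  rw [intervalIntegral.integral_sub iD
    (cB.intervalIntegrable _ _), intervalIntegral.integral_sub (cSV.intervalIntegrable _ _)
    (iV _ _)]
  abel

end Semigroup

/-! ### Weak derivatives and primitives on the half line. -/

section WeakDerivative

variable {E : Type*} [NormedAddCommGroup E] [NormedSpace ℝ E]

theorem exists_Ioo_of_test {φ : ℝ → ℝ} (hc : HasCompactSupport φ) (hs : tsupport φ ⊆ Ioi 0) :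
    ∃ a b : ℝ, 0 < a ∧ a < b ∧ tsupport φ ⊆ Icc a b := by
  obtain ⟨b, hb⟩ := hc.isCompact.bddAbove
  rcases (tsupport φ).eq_empty_or_nonempty with h | h
  · exact ⟨1, 2, one_pos, by norm_num, by simp [h]⟩
  · obtain ⟨a, ha, hmin⟩ := hc.isCompact.exists_isLeast h
    have ha' : 0 < a := hs ha
    refine ⟨a, max b (a + 1), ha', lt_of_lt_of_le (lt_add_one a) (le_max_right _ _), fun x hx =>
      ⟨hmin hx, (hb hx).trans (le_max_left _ _)⟩⟩

theorem integral_Ioi_eq_of_support {f : ℝ → E} {b : ℝ} (hf : ∀ x, b < x → f x = 0) :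
    ∫ x in Ioi 0, f x = ∫ x in Ioc 0 b, f x :=
  setIntegral_eq_of_subset_of_forall_sdiff_eq_zero measurableSet_Ioi Ioc_subset_Ioi_self
    fun x hx => hf x (not_le.1 fun h => hx.2 ⟨hx.1, h⟩)

/-- Integration by parts of a test function against a primitive of a locally integrable function. -/
theorem integral_deriv_smul_primitive [CompleteSpace E] {g : ℝ → E}
    (hg : ∀ s, IntegrableOn g (Ioc 0 s))
    {φ : ℝ → ℝ} (hφ : ContDiff ℝ ((⊤ : ℕ∞) : WithTop ℕ∞) φ) (hc : HasCompactSupport φ)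
    (hs : tsupport φ ⊆ Ioi 0) :
    ∫ s in Ioi 0, deriv φ s • ∫ σ in (0 : ℝ)..s, g σ = -∫ s in Ioi 0, φ s • g s := by
  obtain ⟨a, b, ha, hab, hsub⟩ := exists_Ioo_of_test hc hs
  have hφb (x : ℝ) (hx : b < x) : φ x = 0 :=
    image_eq_zero_of_notMem_tsupport fun h => absurd (hsub h).2 (not_le.2 hx)
  set R := b + 1
  have hd (x : ℝ) (hx : R < x) : deriv φ x = 0 :=
    Function.notMem_support.1 fun h =>
      absurd (hsub (support_deriv_subset h)).2 (not_le.2 (by linarith))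
  have hφR : φ R = 0 := hφb R (lt_add_one b)
  have hφd : Continuous (deriv φ) := hφ.continuous_deriv (by simp)
  rw [integral_Ioi_eq_of_support (b := R) fun x hx => by rw [hd x hx, zero_smul],
    integral_Ioi_eq_of_support (b := R) fun x hx => by rw [hφb x (by linarith), zero_smul]]
  -- Fubini on the triangle `σ ≤ s`: the inner integral of `deriv φ` over `[σ, R]` is `-φ σ`,
  -- because `R` lies beyond the support.
  set F : ℝ × ℝ → E := {q : ℝ × ℝ | q.2 ≤ q.1}.indicator fun q => deriv φ q.1 • g q.2 with hF
  have hFi : Integrable F ((volume.restrict (Ioc 0 R)).prod (volume.restrict (Ioc 0 R))) := by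
    refine Integrable.indicator ?_ (measurableSet_le measurable_snd measurable_fst)
    exact Integrable.smul_prod (hφd.integrableOn_Ioc) (hg R)
  have e1 : ∀ s ∈ Ioc 0 R, deriv φ s • ∫ σ in (0 : ℝ)..s, g σ = ∫ σ in Ioc 0 R, F (s, σ) := by
    intro s hs
    have : (fun σ => F (s, σ)) = (Iic s).indicator fun σ => deriv φ s • g σ := by
      ext σ; simp [hF, indicator_apply]
    rw [this, setIntegral_indicator measurableSet_Iic, integral_smul,
      intervalIntegral.integral_of_le hs.1.le, Ioc_inter_Iic, min_eq_right hs.2]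
  have e2 : ∀ σ ∈ Ioc 0 R, ∫ s in Ioc 0 R, F (s, σ) = -(φ σ • g σ) := by
    intro σ hσ
    have : (fun s => F (s, σ)) = (Ici σ).indicator fun s => deriv φ s • g σ := by
      ext s; simp [hF, indicator_apply]
    have h2 : Ioc 0 R ∩ Ici σ = Icc σ R := by
      ext x; simp only [mem_inter_iff, mem_Ioc, mem_Ici, mem_Icc]
      exact ⟨fun h => ⟨h.2, h.1.2⟩, fun h => ⟨⟨hσ.1.trans_le h.1, h.2⟩, h.1⟩⟩
    rw [this, setIntegral_indicator measurableSet_Ici, h2, integral_smul_const,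
      integral_Icc_eq_integral_Ioc, ← intervalIntegral.integral_of_le hσ.2,
      intervalIntegral.integral_deriv_eq_sub
        (fun x _ => (hφ.differentiable (by simp)).differentiableAt)
        (hφd.intervalIntegrable _ _), hφR, zero_sub, neg_smul]
  rw [setIntegral_congr_fun measurableSet_Ioc e1,
    integral_integral_swap (f := fun s σ => F (s, σ)) hFi,
    setIntegral_congr_fun measurableSet_Ioc e2, integral_neg]

theorem integrable_test_smul {h : ℝ → E} (hh : ContinuousOn h (Ioi 0))
    {φ : ℝ → ℝ} (hφ : Continuous φ) (hc : HasCompactSupport φ) (hs : tsupport φ ⊆ Ioi 0) :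
    IntegrableOn (fun x => φ x • h x) (Ioi 0) := by
  have h1 : IntegrableOn (fun x => φ x • h x) (tsupport φ) :=
    (hφ.continuousOn.smul (hh.mono hs)).integrableOn_compact hc
  refine (h1.integrable_of_forall_notMem_eq_zero fun x hx => ?_).integrableOn
  rw [image_eq_zero_of_notMem_tsupport hx, zero_smul]

/-- The du Bois-Reymond lemma on the half line, for continuous functions. -/
theorem exists_const_of_weakDeriv_zero [CompleteSpace E] {h : ℝ → E} (hh : ContinuousOn h (Ioi 0))
    (hw : ∀ φ : ℝ → ℝ, ContDiff ℝ ((⊤ : ℕ∞) : WithTop ℕ∞) φ → HasCompactSupport φ →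
      tsupport φ ⊆ Ioi 0 → ∫ s in Ioi 0, deriv φ s • h s = 0) :
    ∃ c, ∀ s > 0, h s = c := by
  let f : ContDiffBump (1 : ℝ) := ⟨1 / 4, 1 / 2, by norm_num, by norm_num⟩
  set χ : ℝ → ℝ := f.normed volume with hχdef
  have hχ : ContDiff ℝ ((⊤ : ℕ∞) : WithTop ℕ∞) χ := f.contDiff_normed
  have hχc : HasCompactSupport χ := f.hasCompactSupport_normed
  have hχs : tsupport χ ⊆ Ioi 0 := by
    rw [hχdef, f.tsupport_normed_eq, Real.closedBall_eq_Icc]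
    intro x hx
    have : (1 : ℝ) - 1 / 2 ≤ x := hx.1
    exact lt_of_lt_of_le (by norm_num) this
  have hχi : ∫ x, χ x = 1 := f.integral_normed
  set c := ∫ s in Ioi 0, χ s • h s with hcdef
  refine ⟨c, ?_⟩
  have hae : ∀ᵐ x : ℝ, x ∈ Ioi (0 : ℝ) → h x - c = 0 := by
    refine IsOpen.ae_eq_zero_of_integral_contDiff_smul_eq_zero isOpen_Ioi
      ((hh.sub continuousOn_const).locallyIntegrableOn measurableSet_Ioi) fun ψ hψ hψc hψs => ?_
    set m := ∫ x, ψ x with hm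
    -- Removing the mean with the normalized bump `χ` leaves a function of integral zero. Its
    -- primitive has compact support in the open half line and is therefore an admissible test
    -- function.
    set θ : ℝ → ℝ := fun x => ψ x - m * χ x with hθdef
    have hθ : ContDiff ℝ ((⊤ : ℕ∞) : WithTop ℕ∞) θ := hψ.sub (contDiff_const.mul hχ)
    set φ : ℝ → ℝ := fun x => ∫ y in (0 : ℝ)..x, θ y with hφdef
    have hφd (x : ℝ) : HasDerivAt φ (θ x) x := intervalIntegral.integral_hasDerivAt_right
      (hθ.continuous.intervalIntegrable _ _) (hθ.continuous.stronglyMeasurableAtFilter _ _)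
      hθ.continuous.continuousAt
    have hφd' : deriv φ = θ := funext fun x => (hφd x).deriv
    have hφ : ContDiff ℝ ((⊤ : ℕ∞) : WithTop ℕ∞) φ :=
      contDiff_infty_iff_deriv.2 ⟨fun x => (hφd x).differentiableAt, by rwa [hφd']⟩
    obtain ⟨a₁, b₁, ha₁, hab₁, hs₁⟩ := exists_Ioo_of_test hψc hψs
    obtain ⟨a₂, b₂, ha₂, hab₂, hs₂⟩ := exists_Ioo_of_test hχc hχs
    have hθ0 (x : ℝ) (hx : x ∉ Icc (min a₁ a₂) (max b₁ b₂)) : θ x = 0 := by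
      have h1 : ψ x = 0 := image_eq_zero_of_notMem_tsupport fun h => hx
        ⟨(min_le_left _ _).trans (hs₁ h).1, (hs₁ h).2.trans (le_max_left _ _)⟩
      have h2 : χ x = 0 := image_eq_zero_of_notMem_tsupport fun h => hx
        ⟨(min_le_right _ _).trans (hs₂ h).1, (hs₂ h).2.trans (le_max_right _ _)⟩
      simp [hθdef, h1, h2]
    have hψi : Integrable ψ := hψ.continuous.integrable_of_hasCompactSupport hψc
    have hχint : Integrable χ := hχ.continuous.integrable_of_hasCompactSupport hχc
    have hθi : ∫ x, θ x = 0 := by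
      simp only [hθdef]
      rw [integral_sub hψi (hχint.const_mul m), integral_const_mul, hχi, mul_one, sub_self]
    have ha : 0 < min a₁ a₂ := lt_min ha₁ ha₂
    have hφs : Function.support φ ⊆ Icc (min a₁ a₂) (max b₁ b₂) := by
      intro x hx
      by_contra hcon
      apply hx
      rw [mem_Icc, not_and_or, not_le, not_le] at hcon
      rcases hcon with hlt | hlt
      · refine intervalIntegral.integral_zero_ae (Eventually.of_forall fun y hy => hθ0 y fun h => ?_)
        rcases mem_uIoc.1 hy with h3 | h3
        · exact absurd (h.1.trans h3.2) (not_le.2 hlt)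
        · exact absurd (h.1.trans h3.2) (not_le.2 ha)
      · have hx0 : 0 ≤ x := by
          have : a₁ < max b₁ b₂ := hab₁.trans_le (le_max_left _ _)
          linarith
        simp only [hφdef]
        rw [intervalIntegral.integral_of_le hx0]
        refine Eq.trans ?_ hθi
        refine setIntegral_eq_integral_of_forall_compl_eq_zero fun y hy => hθ0 y fun h => hy ?_
        exact ⟨ha.trans_le h.1, h.2.trans hlt.le⟩
    have hφt : tsupport φ ⊆ Icc (min a₁ a₂) (max b₁ b₂) := closure_minimal hφs isClosed_Icc
    have key := hw φ hφ (HasCompactSupport.of_support_subset_isCompact isCompact_Icc hφs)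
      (hφt.trans fun x hx => ha.trans_le hx.1)
    rw [hφd'] at key
    have i1 := integrable_test_smul hh hψ.continuous hψc hψs
    have i2 := integrable_test_smul hh hχ.continuous hχc hχs
    have e1 : ∫ s in Ioi 0, θ s • h s = (∫ s in Ioi 0, ψ s • h s) - m • c := by
      rw [hcdef, ← integral_smul]
      refine Eq.trans ?_ (integral_sub i1 (i2.smul m))
      refine integral_congr_ae (Eventually.of_forall fun s => ?_)
      simp only [hθdef, sub_smul, mul_smul]
    have hzero (x : ℝ) (hx : x ∉ Ioi (0 : ℝ)) : ψ x = 0 :=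
      image_eq_zero_of_notMem_tsupport fun h => hx (hψs h)
    have hm' : m = ∫ x in Ioi 0, ψ x :=
      (setIntegral_eq_integral_of_forall_compl_eq_zero hzero).symm
    rw [← setIntegral_eq_integral_of_forall_compl_eq_zero (s := Ioi (0 : ℝ))
      fun x hx => by rw [hzero x hx, zero_smul]]
    have e2 : ∫ s in Ioi 0, ψ s • (h s - c) = (∫ s in Ioi 0, ψ s • h s) - m • c := by
      simp only [smul_sub]
      rw [integral_sub i1 (hψi.integrableOn.smul_const c), integral_smul_const, hm']
    rw [e2, ← e1, key]
  have heq : EqOn h (fun _ => c) (Ioi 0) := by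
    refine Measure.eqOn_open_of_ae_eq (μ := volume) ?_ isOpen_Ioi hh continuousOn_const
    refine (ae_restrict_iff' measurableSet_Ioi).2 (hae.mono fun x hx hx0 => sub_eq_zero.1 (hx hx0))
  exact fun s hs => heq hs

/-- A function with locally integrable weak derivative that vanishes at zero is the primitive of
its weak derivative. -/
theorem IsWeakDeriv.ae_eq_primitive [CompleteSpace E] {η g : ℝ → E}
    (hg : ∀ s, IntegrableOn g (Ioc 0 s)) (h : IsWeakDeriv η g) (h0 : VanishesAtZero η) :
    η =ᵐ[volume.restrict (Ioi 0)] fun s => ∫ σ in (0 : ℝ)..s, g σ := by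
  obtain ⟨η', hc, hz, hae⟩ := h0
  set G : ℝ → E := fun s => ∫ σ in (0 : ℝ)..s, g σ with hGdef
  have hG : ContinuousOn G (Ici 0) := by
    intro s hs
    have h1 : ContinuousOn G (Icc 0 (s + 1)) := by
      have hs' : (0 : ℝ) ≤ s + 1 := by have : (0 : ℝ) ≤ s := hs; linarith
      have := intervalIntegral.continuousOn_primitive_interval (μ := volume) (f := g)
        (a := 0) (b := s + 1) (by
          rw [uIcc_of_le hs', integrableOn_Icc_iff_integrableOn_Ioc]; exact hg _)
      rwa [uIcc_of_le hs'] at this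
    refine (h1 s ⟨hs, (lt_add_one s).le⟩).mono_of_mem_nhdsWithin ?_
    rw [← Ici_inter_Iic]
    exact inter_mem_nhdsWithin _ (Iic_mem_nhds (lt_add_one s))
  have hd : ContinuousOn (fun s => η' s - G s) (Ici 0) := hc.sub hG
  obtain ⟨c, hcst⟩ := exists_const_of_weakDeriv_zero (hd.mono Ioi_subset_Ici_self) fun φ hφ hφc hφs => by
    have hd1 := hφ.continuous_deriv (by simp)
    have i1 := integrable_test_smul (hc.mono Ioi_subset_Ici_self) hd1 hφc.deriv
      ((tsupport_deriv_subset).trans hφs)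
    have i2 := integrable_test_smul (hG.mono Ioi_subset_Ici_self) hd1 hφc.deriv
      ((tsupport_deriv_subset).trans hφs)
    simp only [smul_sub]
    rw [integral_sub i1 i2, integral_deriv_smul_primitive hg hφ hφc hφs, ← h φ hφ hφc hφs,
      sub_eq_zero]
    exact integral_congr_ae (hae.mono fun x hx => by simp only [hx])
  -- Both functions are continuous up to zero and vanish there, which fixes the constant.
  have hc0 : c = 0 := by
    have h1 : Tendsto (fun s => η' s - G s) (𝓝[>] 0) (𝓝 (η' 0 - G 0)) :=
      (hd 0 self_mem_Ici).mono_left (nhdsWithin_mono _ Ioi_subset_Ici_self)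
    have h2 : Tendsto (fun s => η' s - G s) (𝓝[>] 0) (𝓝 c) :=
      tendsto_const_nhds.congr' (eventually_nhdsWithin_of_forall fun s hs => (hcst s hs).symm)
    have := tendsto_nhds_unique h2 h1
    simpa [hz, hGdef] using this
  filter_upwards [hae, ae_restrict_mem measurableSet_Ioi] with s hs hs0
  rw [hs, ← sub_eq_zero, ← hc0]
  exact hcst s hs0

end WeakDerivative

/-! ### Backward uniqueness for the transport equation. -/

section Transport

variable {G : Type*} [NormedAddCommGroup G] [NormedSpace ℝ G] [CompleteSpace G]

theorem hasDerivAt_integral_lower {f : ℝ → G} (hf : Continuous f) (T t : ℝ) :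
    HasDerivAt (fun t => ∫ r in t..T, f r) (-f t) t :=
  intervalIntegral.integral_hasDerivAt_left (hf.intervalIntegrable _ _)
    (hf.stronglyMeasurableAtFilter _ _) hf.continuousAt

theorem eqOn_zero_of_integral_eq_zero {f : ℝ → G} {T : ℝ} (hT : 0 < T)
    (hf : ContinuousOn f (Icc 0 T)) (h : ∀ t ∈ Icc 0 T, ∫ r in t..T, f r = 0) :
    ∀ t ∈ Icc 0 T, f t = 0 := by
  set g : ℝ → G := IccExtend hT.le ((Icc 0 T).domRestrict f) with hg
  have hgc : Continuous g := (continuousOn_iff_continuous_domRestrict.1 hf).Icc_extend'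
  have hgf (t : ℝ) (ht : t ∈ Icc 0 T) : g t = f t := by
    rw [hg, IccExtend_of_mem _ _ ht]; rfl
  have h1 : ∀ t ∈ Ioo 0 T, g t = 0 := by
    intro t ht
    have h2 : (fun t => ∫ r in t..T, g r) =ᶠ[𝓝 t] fun _ => 0 := by
      filter_upwards [Ioo_mem_nhds ht.1 ht.2] with s hs
      rw [← h s ⟨hs.1.le, hs.2.le⟩]
      refine intervalIntegral.integral_congr fun r hr => ?_
      rw [uIcc_of_le hs.2.le] at hr
      exact hgf r ⟨hs.1.le.trans hr.1, hr.2⟩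
    have h3 := ((hasDerivAt_const t (0 : G)).congr_of_eventuallyEq h2).unique
      (hasDerivAt_integral_lower hgc T t)
    exact neg_eq_zero.1 h3.symm
  have h2 : EqOn g (fun _ => 0) (closure (Ioo 0 T)) :=
    EqOn.closure h1 hgc continuous_const
  rw [closure_Ioo hT.ne] at h2
  intro t ht
  rw [← hgf t ht, h2 ht]

/-- With `P t s = ∫ σ in 0..s, n t σ` the hypothesis reads `P_t + P_s = -s a` and `P T = 0`. A
particular solution is `s b + c`, with `b` and `c` the first and second backward primitives of `a`.
Characteristics give `P = s b + c`, and `P = 0` at `s = 0` forces `c`, then `b`, then `a` to vanish.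
-/
theorem transport_eq_zero_of_continuous {T : ℝ} (hT : 0 < T) {n : ℝ → ℝ → G} {a : ℝ → G}
    (hn : Continuous fun q : ℝ × ℝ => n q.1 q.2) (ha : Continuous a)
    (h : ∀ t ∈ Icc 0 T, ∀ s ≥ 0, ∫ σ in (0 : ℝ)..s, n t σ = ∫ r in t..T, (n r s + s • a r)) :
    ∀ t ∈ Icc 0 T, a t = 0 ∧ ∀ s ≥ 0, n t s = 0 := by
  have hn1 (t : ℝ) : Continuous (n t) := hn.comp (continuous_const.prodMk continuous_id)
  have hn2 (s : ℝ) : Continuous fun t => n t s := hn.comp (continuous_id.prodMk continuous_const)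
  set P : ℝ → ℝ → G := fun t s => ∫ σ in (0 : ℝ)..s, n t σ with hP
  set b : ℝ → G := fun t => ∫ r in t..T, a r with hb
  have hbd (t : ℝ) : HasDerivAt b (-a t) t := hasDerivAt_integral_lower ha T t
  have hbc : Continuous b := continuous_iff_continuousAt.2 fun t => (hbd t).continuousAt
  set c : ℝ → G := fun t => ∫ r in t..T, b r with hc
  have hcd (t : ℝ) : HasDerivAt c (-b t) t := hasDerivAt_integral_lower hbc T t
  have hPc : Continuous fun q : ℝ × ℝ => P q.1 q.2 := by
    have := intervalIntegral.continuous_parametric_intervalIntegral_of_continuous (μ := volume)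
      (f := fun (q : ℝ × ℝ) σ => n q.1 σ) (a₀ := 0) (s := fun q : ℝ × ℝ => q.2)
      (by exact hn.comp ((continuous_fst.comp continuous_fst).prodMk continuous_snd))
      continuous_snd
    exact this
  have hPs (t s : ℝ) : HasDerivAt (P t) (n t s) s :=
    intervalIntegral.integral_hasDerivAt_right ((hn1 t).intervalIntegrable _ _)
      ((hn1 t).stronglyMeasurableAtFilter _ _) (hn1 t).continuousAt
  have hPt (t s : ℝ) (ht : t ∈ Ioo 0 T) (hs : 0 < s) :
      HasDerivAt (fun t => P t s) (-(n t s + s • a t)) t := by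
    refine (hasDerivAt_integral_lower (f := fun r => n r s + s • a r)
      ((hn2 s).add (ha.const_smul s)) T t).congr_of_eventuallyEq ?_
    filter_upwards [Ioo_mem_nhds ht.1 ht.2] with r hr
    exact h r ⟨hr.1.le, hr.2.le⟩ s hs.le
  -- Continuity of both partial derivatives gives the total derivative needed for the chain rule
  -- along characteristics.
  have hPF (t s : ℝ) (ht : t ∈ Ioo 0 T) (hs : 0 < s) :
      HasFDerivAt (fun q : ℝ × ℝ => P q.1 q.2)
        ((ContinuousLinearMap.toSpanSingleton ℝ (-(n t s + s • a t))).coprod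
          (ContinuousLinearMap.toSpanSingleton ℝ (n t s))) (t, s) := by
    have hmem : ∀ᶠ v : ℝ × ℝ in 𝓝 (t, s), v.1 ∈ Ioo 0 T ∧ 0 < v.2 :=
      (continuous_fst.continuousAt.eventually_mem (Ioo_mem_nhds ht.1 ht.2)).and
        (continuous_snd.continuousAt.eventually_mem (Ioi_mem_nhds hs))
    have hsp : Continuous fun x : G => ContinuousLinearMap.toSpanSingleton ℝ x :=
      (ContinuousLinearMap.toSpanSingletonLIE ℝ G).continuous
    refine (hasStrictFDerivAt_uncurry_coprod (𝕜 := ℝ) (u := (t, s)) (f := P)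
      (f₁ := fun t s => ContinuousLinearMap.toSpanSingleton ℝ (-(n t s + s • a t)))
      (f₂ := fun t s => ContinuousLinearMap.toSpanSingleton ℝ (n t s)) ?_ ?_ ?_ ?_).hasFDerivAt
    · filter_upwards [hmem] with v hv
      exact (hPt v.1 v.2 hv.1 hv.2).hasFDerivAt
    · exact Eventually.of_forall fun v => (hPs v.1 v.2).hasFDerivAt
    · refine Continuous.continuousAt (hsp.comp ?_)
      exact (hn.add (continuous_snd.smul (ha.comp continuous_fst))).neg
    · exact Continuous.continuousAt (hsp.comp hn)
  -- `P - s b - c` is constant along the characteristics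
  have hchar (t s : ℝ) (ht : t ∈ Icc 0 T) (hs : 0 ≤ s) : P t s = s • b t + c t := by
    set Q : ℝ → G := fun r => P r (s + r - t) - (s + r - t) • b r - c r with hQ
    have hQc : Continuous Q := by
      have h1 : Continuous fun r => P r (s + r - t) :=
        hPc.comp (continuous_id.prodMk (by fun_prop))
      have h2 : Continuous c := continuous_iff_continuousAt.2 fun t => (hcd t).continuousAt
      fun_prop
    have hQd (r : ℝ) (hr : r ∈ Ioo t T) : HasDerivAt Q 0 r := by
      have hp : 0 < s + r - t := by linarith [hr.1]
      have hr0 : r ∈ Ioo 0 T := ⟨ht.1.trans_lt hr.1, hr.2⟩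
      have h1 : HasDerivAt (fun r : ℝ => s + r - t) 1 r :=
        ((hasDerivAt_id r).const_add s).sub_const t
      have h2 := (hPF r _ hr0 hp).comp_hasDerivAt r ((hasDerivAt_id r).prodMk h1)
      have h3 := (h2.sub (h1.smul (hbd r))).sub (hcd r)
      refine h3.congr_deriv ?_
      simp [ContinuousLinearMap.coprod_apply]
    have hQT : Q T = 0 := by
      have h1 := h T ⟨hT.le, le_rfl⟩ (s + T - t) (by linarith [ht.2])
      simp only [intervalIntegral.integral_same] at h1
      simp only [hQ, hP, hb, hc, intervalIntegral.integral_same, smul_zero, sub_zero]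
      exact h1
    have hQt : Q t = 0 := by
      rcases ht.2.eq_or_lt with rfl | htT
      · exact hQT
      -- The derivative is available only for interior times and `s > 0`, and the starting point may
      -- lie on the boundary; continuity of `Q` extends the conclusion to `r = t`.
      have h6 : EqOn Q (fun _ => 0) (Ioo t T) := fun r hr => by
        have h7 := constant_of_has_deriv_right_zero (f := Q) (a := r) (b := T) hQc.continuousOn
          (fun x hx => (hQd x ⟨hr.1.trans_le hx.1, hx.2⟩).hasDerivWithinAt) T ⟨hr.2.le, le_rfl⟩
        rw [← h7, hQT]
      have h8 := h6.closure hQc continuous_const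
      rw [closure_Ioo htT.ne] at h8
      exact h8 ⟨le_rfl, htT.le⟩
    have h5 : P t s - s • b t - c t = 0 := by
      simpa [hQ] using hQt
    rw [sub_sub, sub_eq_zero] at h5
    exact h5
  have hc0 : ∀ t ∈ Icc 0 T, c t = 0 := fun t ht => by
    have := hchar t 0 ht le_rfl
    simpa [hP] using this.symm
  have hb0 : ∀ t ∈ Icc 0 T, b t = 0 := eqOn_zero_of_integral_eq_zero hT hbc.continuousOn hc0
  have ha0 : ∀ t ∈ Icc 0 T, a t = 0 := eqOn_zero_of_integral_eq_zero hT ha.continuousOn hb0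
  refine fun t ht => ⟨ha0 t ht, ?_⟩
  have hP0 (s : ℝ) (hs : 0 ≤ s) : P t s = 0 := by
    rw [hchar t s ht hs, hb0 t ht, hc0 t ht, smul_zero, add_zero]
  have hn0 : EqOn (n t) (fun _ => 0) (Ioi 0) := by
    intro s hs
    have h2 : P t =ᶠ[𝓝 s] fun _ => 0 := by
      filter_upwards [Ioi_mem_nhds hs] with r hr using hP0 r (le_of_lt hr)
    exact (hPs t s).unique ((hasDerivAt_const s (0 : G)).congr_of_eventuallyEq h2)
  have := hn0.closure (hn1 t) continuous_const
  rw [closure_Ioi] at this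
  exact fun s hs => this hs

/-- Backward uniqueness for the transport equation `y_t + y_s = -a'` on the half line, in
integrated form, with vanishing data at the terminal time and at `s = 0`. -/
theorem transport_eq_zero {T : ℝ} (hT : 0 < T) {n : ℝ → ℝ → G} {a : ℝ → G}
    (hn : ContinuousOn (fun q : ℝ × ℝ => n q.1 q.2) (Icc 0 T ×ˢ Ici 0))
    (ha : ContinuousOn a (Icc 0 T))
    (h : ∀ t ∈ Icc 0 T, ∀ s ≥ 0, ∫ σ in (0 : ℝ)..s, n t σ = ∫ r in t..T, (n r s + s • a r)) :
    ∀ t ∈ Icc 0 T, a t = 0 ∧ ∀ s ≥ 0, n t s = 0 := by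
  set π : ℝ → ℝ := fun t => max 0 (min t T) with hπ
  have hπc : Continuous π := by fun_prop
  have hπm (t : ℝ) : π t ∈ Icc 0 T := ⟨le_max_left _ _, max_le hT.le (min_le_right _ _)⟩
  have hπe (t : ℝ) (ht : t ∈ Icc 0 T) : π t = t := by
    simp only [hπ]; rw [min_eq_left ht.2, max_eq_right ht.1]
  have key := transport_eq_zero_of_continuous hT (n := fun t s => n (π t) (max s 0))
    (a := fun t => a (π t)) ?_ ?_ ?_
  · intro t ht
    obtain ⟨h1, h2⟩ := key t ht
    simp only [hπe t ht] at h1 h2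
    exact ⟨h1, fun s hs => by simpa [max_eq_left hs] using h2 s hs⟩
  · exact hn.comp_continuous (f := fun q : ℝ × ℝ => (π q.1, max q.2 0))
      (by fun_prop) fun q => ⟨hπm _, mem_Ici.2 (le_max_right _ _)⟩
  · exact ha.comp_continuous hπc hπm
  · intro t ht s hs
    have e1 : ∫ σ in (0 : ℝ)..s, n (π t) (max σ 0) = ∫ σ in (0 : ℝ)..s, n t σ := by
      refine intervalIntegral.integral_congr fun σ hσ => ?_
      rw [uIcc_of_le hs] at hσ
      simp only [hπe t ht, max_eq_left hσ.1]
    rw [e1, h t ht s hs]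
    refine intervalIntegral.integral_congr fun r hr => ?_
    rw [uIcc_of_le ht.2] at hr
    simp only [hπe r ⟨ht.1.trans hr.1, hr.2⟩, max_eq_left hs]

end Transport

/-! ### Positivity and monotonicity of the memory weights. -/

section MemoryKernel

theorem IsMemoryKernel.antitoneOn {c δ : ℝ} {k μ : ℝ → ℝ} (h : IsMemoryKernel c k μ δ) :
    AntitoneOn μ (Ici 0) := by
  refine antitoneOn_of_deriv_nonpos (convex_Ici 0) h.continuousOn ?_ ?_
  · rw [interior_Ici]; exact h.contDiffOn.differentiableOn (by simp)
  · intro x hx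
    rw [interior_Ici] at hx
    have h1 := h.decay x hx
    have h2 := mul_nonneg h.delta_pos.le (h.nonneg x hx)
    linarith

/-- A nonincreasing nonnegative weight that vanishes once vanishes from then on, and `k` would be
constant there, against strict decrease. -/
theorem IsMemoryKernel.pos {c δ : ℝ} {k μ : ℝ → ℝ} (h : IsMemoryKernel c k μ δ) (hc : 0 < c)
    {s : ℝ} (hs : 0 < s) : 0 < μ s := by
  by_contra hcon
  have h0 : ∀ x ≥ s, μ x = 0 := fun x hx => by
    have hx0 : 0 < x := hs.trans_le hx
    exact le_antisymm ((h.antitoneOn (mem_Ici.2 hs.le) (mem_Ici.2 hx0.le) hx).trans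
      (not_lt.1 hcon)) (h.nonneg x hx0)
  have hd : ∀ x ≥ s, HasDerivAt (fun s => c * k s) 0 x := fun x hx => by
    have := h.hasDerivAt x (hs.trans_le hx)
    rwa [h0 x hx, neg_zero] at this
  have h1 := constant_of_has_deriv_right_zero (f := fun s => c * k s) (a := s) (b := s + 1)
    (fun x hx => (hd x hx.1).continuousAt.continuousWithinAt)
    (fun x hx => (hd x hx.1).hasDerivWithinAt) (s + 1) ⟨by linarith, le_rfl⟩
  have h2 := h.strictAnti (mem_Ici.2 hs.le) (mem_Ici.2 (by linarith : (0 : ℝ) ≤ s + 1))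
    (lt_add_one s)
  exact h2.ne (mul_left_cancel₀ hc.ne' h1)

end MemoryKernel

/-! ### Primitives and backward uniqueness in the weighted memory space. -/

section MemorySpace

variable {μ : ℝ → ℝ}

theorem volume_absolutelyContinuous_memMeasure (hc : ContinuousOn μ (Ici 0))
    (hpos : ∀ s > 0, 0 < μ s) : volume.restrict (Ioi 0) ≪ memMeasure μ := by
  refine withDensity_absolutelyContinuous' ?_ ?_
  · exact ((hc.mono Ioi_subset_Ici_self).aemeasurable measurableSet_Ioi).ennreal_ofReal
  · refine (ae_restrict_iff' measurableSet_Ioi).2 (Eventually.of_forall fun s hs => ?_)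
    exact (ENNReal.ofReal_pos.2 (hpos s hs)).ne'

/-- On `(0, R]` the weight is at least `μ R > 0`. Weighted square integrability therefore yields
local integrability up to zero. -/
theorem volume_le_smul_memMeasure (hpos : ∀ s > 0, 0 < μ s) (hanti : AntitoneOn μ (Ici 0))
    {R : ℝ} (hR : 0 < R) :
    volume.restrict (Ioc 0 R) ≤ (ENNReal.ofReal (μ R))⁻¹ • memMeasure μ := by
  have h0 : ENNReal.ofReal (μ R) ≠ 0 := (ENNReal.ofReal_pos.2 (hpos R hR)).ne'
  refine Measure.le_iff.2 fun B hB => ?_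
  rw [Measure.smul_apply, smul_eq_mul, ← ENNReal.mul_le_iff_le_inv h0 ENNReal.ofReal_ne_top,
    memMeasure, withDensity_apply _ hB, Measure.restrict_restrict hB, Measure.restrict_apply hB]
  calc ENNReal.ofReal (μ R) * volume (B ∩ Ioc 0 R)
      = ∫⁻ _ in B ∩ Ioc 0 R, ENNReal.ofReal (μ R) := by rw [setLIntegral_const]
    _ ≤ ∫⁻ s in B ∩ Ioc 0 R, ENNReal.ofReal (μ s) :=
        setLIntegral_mono' (hB.inter measurableSet_Ioc) fun s hs =>
          ENNReal.ofReal_le_ofReal (hanti (mem_Ici.2 hs.2.1.le) (mem_Ici.2 hR.le) hs.2.2)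
    _ ≤ ∫⁻ s in B ∩ Ioi 0, ENNReal.ofReal (μ s) :=
        lintegral_mono_set (inter_subset_inter_right _ Ioc_subset_Ioi_self)

theorem Mem.memLp_Ioc {E : Type*} [NormedAddCommGroup E] (hpos : ∀ s > 0, 0 < μ s) (hanti : AntitoneOn μ (Ici 0))
    (η : Mem μ E) {R : ℝ} (hR : 0 < R) : MemLp η 2 (volume.restrict (Ioc 0 R)) :=
  (Lp.memLp η).of_measure_le_smul
    (ENNReal.inv_ne_top.2 (ENNReal.ofReal_pos.2 (hpos R hR)).ne')
    (volume_le_smul_memMeasure hpos hanti hR)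

variable {E : Type*} [NormedAddCommGroup E]

theorem Mem.integrableOn_Ioc (hpos : ∀ s > 0, 0 < μ s) (hanti : AntitoneOn μ (Ici 0))
    (η : Mem μ E) (R : ℝ) : IntegrableOn η (Ioc 0 R) := by
  rcases lt_or_ge 0 R with hR | hR
  · exact (Mem.memLp_Ioc hpos hanti η hR).integrable (by norm_num)
  · simp [Ioc_eq_empty (not_lt.2 hR)]

variable [NormedSpace ℝ E]

theorem Mem.exists_integral_bound (hpos : ∀ s > 0, 0 < μ s) (hanti : AntitoneOn μ (Ici 0))
    {R : ℝ} (hR : 0 < R) : ∃ C : ℝ, 0 ≤ C ∧ ∀ η : Mem μ E, ∀ s ∈ Icc 0 R,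
      ‖∫ σ in (0 : ℝ)..s, η σ‖ ≤ C * ‖η‖ := by
  set c := (ENNReal.ofReal (μ R))⁻¹ with hc
  have hc' : c ≠ ∞ := ENNReal.inv_ne_top.2 (ENNReal.ofReal_pos.2 (hpos R hR)).ne'
  -- The first factor compares the two measures in `L²`; the second is the Cauchy–Schwarz constant
  -- `R ^ (1/2)` from `L²` to `L¹`.
  set K : ℝ≥0∞ := c ^ (1 / (2 : ℝ≥0∞)).toReal *
    (volume.restrict (Ioc 0 R)) univ ^ (1 / (1 : ℝ≥0∞).toReal - 1 / (2 : ℝ≥0∞).toReal) with hK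
  have hKtop : K ≠ ∞ := by
    refine ENNReal.mul_ne_top (ENNReal.rpow_ne_top_of_nonneg ENNReal.toReal_nonneg hc') ?_
    exact ENNReal.rpow_ne_top_of_nonneg (by norm_num) (measure_ne_top _ _)
  refine ⟨K.toReal, ENNReal.toReal_nonneg, fun η s hs => ?_⟩
  have hm := Mem.memLp_Ioc hpos hanti η hR
  have h1 : eLpNorm η 1 (volume.restrict (Ioc 0 R)) ≤ K * eLpNorm η 2 (memMeasure μ) := by
    refine (eLpNorm_le_eLpNorm_mul_rpow_measure_univ (p := 1) (q := 2) (by norm_num)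
      hm.1).trans ?_
    have h2 := eLpNorm_le_of_measure_le_smul (f := (η : ℝ → E)) (p := 2)
      (volume_le_smul_memMeasure hpos hanti hR)
    rw [smul_eq_mul] at h2
    calc _ ≤ _ := mul_le_mul_left h2 _
      _ = _ := by rw [hK, mul_right_comm]
  have h3 : ‖∫ σ in (0 : ℝ)..s, η σ‖ ≤ ∫ σ in Ioc 0 R, ‖η σ‖ := by
    refine (intervalIntegral.norm_integral_le_integral_norm hs.1).trans ?_
    rw [intervalIntegral.integral_of_le hs.1]
    exact setIntegral_mono_set (Mem.integrableOn_Ioc hpos hanti η R).norm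
      (Eventually.of_forall fun _ => norm_nonneg _) (Ioc_subset_Ioc_right hs.2).eventuallyLE
  refine h3.trans ?_
  rw [integral_norm_eq_lintegral_enorm hm.1, ← eLpNorm_one_eq_lintegral_enorm, Lp.norm_def,
    ← ENNReal.toReal_mul]
  exact ENNReal.toReal_mono (ENNReal.mul_ne_top hKtop (Lp.memLp η).2.ne) h1

theorem Mem.continuousOn_primitive (hpos : ∀ s > 0, 0 < μ s) (hanti : AntitoneOn μ (Ici 0))
    (η : Mem μ E) : ContinuousOn (fun s => ∫ σ in (0 : ℝ)..s, η σ) (Ici 0) := by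
  intro s hs
  have hs' : (0 : ℝ) ≤ s + 1 := by have : (0 : ℝ) ≤ s := hs; linarith
  have h1 := intervalIntegral.continuousOn_primitive_interval (μ := volume) (f := η)
    (a := 0) (b := s + 1) (by
      rw [uIcc_of_le hs', integrableOn_Icc_iff_integrableOn_Ioc]
      exact Mem.integrableOn_Ioc hpos hanti η _)
  rw [uIcc_of_le hs'] at h1
  refine (h1 s ⟨hs, (lt_add_one s).le⟩).mono_of_mem_nhdsWithin ?_
  rw [← Ici_inter_Iic]
  exact inter_mem_nhdsWithin _ (Iic_mem_nhds (lt_add_one s))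

/-- The primitives of the elements of a memory space, as continuous linear maps. -/
theorem Mem.exists_primitive (hc : ContinuousOn μ (Ici 0)) (hpos : ∀ s > 0, 0 < μ s)
    (hanti : AntitoneOn μ (Ici 0)) :
    ∃ Φ : ℝ → Mem μ E →L[ℝ] E, (∀ s ≥ 0, ∀ η : Mem μ E, Φ s η = ∫ σ in (0 : ℝ)..s, η σ) ∧
      ContinuousOn (fun q : ℝ × Mem μ E => Φ q.1 q.2) (Ici 0 ×ˢ univ) := by
  have hac := volume_absolutelyContinuous_memMeasure hc hpos
  have hI (η : Mem μ E) (s : ℝ) (hs : 0 ≤ s) : IntervalIntegrable η volume 0 s :=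
    (intervalIntegrable_iff_integrableOn_Ioc_of_le hs).2 (Mem.integrableOn_Ioc hpos hanti η s)
  have hcongr {f g : ℝ → E} (h : f =ᵐ[memMeasure μ] g) (s : ℝ) (hs : 0 ≤ s) :
      ∫ σ in (0 : ℝ)..s, f σ = ∫ σ in (0 : ℝ)..s, g σ := by
    rw [intervalIntegral.integral_of_le hs, intervalIntegral.integral_of_le hs]
    exact integral_congr_ae (ae_restrict_of_ae_restrict_of_subset Ioc_subset_Ioi_self (hac h))
  have hex (s : ℝ) : ∃ Φ : Mem μ E →L[ℝ] E, 0 ≤ s → ∀ η : Mem μ E,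
      Φ η = ∫ σ in (0 : ℝ)..s, η σ := by
    rcases lt_or_ge s 0 with hs | hs
    · exact ⟨0, fun h => absurd h (not_le.2 hs)⟩
    obtain ⟨C, hC, hb⟩ := Mem.exists_integral_bound (E := E) hpos hanti
      (R := s + 1) (by linarith)
    let Λ : Mem μ E →ₗ[ℝ] E :=
      { toFun := fun η => ∫ σ in (0 : ℝ)..s, η σ
        map_add' := fun η ζ => by
          rw [hcongr (Lp.coeFn_add η ζ) s hs]
          exact intervalIntegral.integral_add (hI η s hs) (hI ζ s hs)
        map_smul' := fun r η => by
          rw [hcongr (Lp.coeFn_smul r η) s hs]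
          exact intervalIntegral.integral_smul r _ }
    exact ⟨Λ.mkContinuous C fun η => hb η s ⟨hs, by linarith⟩, fun _ η => rfl⟩
  choose Φ hΦ using hex
  refine ⟨Φ, fun s hs => hΦ s hs, ?_⟩
  rintro ⟨s₀, η₀⟩ ⟨hs₀, -⟩
  have hs₀' : (0 : ℝ) ≤ s₀ := hs₀
  obtain ⟨C, hC, hb⟩ := Mem.exists_integral_bound (E := E) hpos hanti
    (R := s₀ + 1) (by linarith)
  have hev : ∀ᶠ q : ℝ × Mem μ E in 𝓝[Ici 0 ×ˢ univ] (s₀, η₀), ‖Φ q.1 q.2 - Φ s₀ η₀‖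
      ≤ C * ‖q.2 - η₀‖ + ‖(∫ σ in (0 : ℝ)..q.1, η₀ σ) - ∫ σ in (0 : ℝ)..s₀, η₀ σ‖ := by
    have h1 : ∀ᶠ q : ℝ × Mem μ E in 𝓝[Ici 0 ×ˢ univ] (s₀, η₀), q.1 < s₀ + 1 :=
      (continuous_fst.continuousAt.eventually_lt continuousAt_const
        (lt_add_one s₀)).filter_mono nhdsWithin_le_nhds
    filter_upwards [h1, self_mem_nhdsWithin] with q hq hq0
    have hq0' : 0 ≤ q.1 := hq0.1
    have e : Φ q.1 q.2 - Φ s₀ η₀ = Φ q.1 (q.2 - η₀)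
        + ((∫ σ in (0 : ℝ)..q.1, η₀ σ) - ∫ σ in (0 : ℝ)..s₀, η₀ σ) := by
      rw [map_sub, ← hΦ q.1 hq0' η₀, ← hΦ s₀ hs₀' η₀]; abel
    rw [e]
    refine (norm_add_le _ _).trans (add_le_add_left ?_ _)
    rw [hΦ q.1 hq0']
    exact hb _ _ ⟨hq0', hq.le⟩
  have hlim : Tendsto (fun q : ℝ × Mem μ E =>
      C * ‖q.2 - η₀‖ + ‖(∫ σ in (0 : ℝ)..q.1, η₀ σ) - ∫ σ in (0 : ℝ)..s₀, η₀ σ‖)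
      (𝓝[Ici 0 ×ˢ univ] (s₀, η₀)) (𝓝 0) := by
    have h1 : ContinuousOn (fun q : ℝ × Mem μ E => ∫ σ in (0 : ℝ)..q.1, η₀ σ)
        (Ici 0 ×ˢ univ) :=
      (Mem.continuousOn_primitive hpos hanti η₀).comp continuousOn_fst fun q hq => hq.1
    have h2 : ContinuousOn (fun q : ℝ × Mem μ E => C * ‖q.2 - η₀‖ +
        ‖(∫ σ in (0 : ℝ)..q.1, η₀ σ) - ∫ σ in (0 : ℝ)..s₀, η₀ σ‖) (Ici 0 ×ˢ univ) :=
      (continuousOn_const.mul (continuousOn_snd.sub continuousOn_const).norm).add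
        (h1.sub continuousOn_const).norm
    simpa using (h2 (s₀, η₀) ⟨hs₀, mem_univ _⟩).tendsto
  exact tendsto_iff_norm_sub_tendsto_zero.2
    (squeeze_zero' (Eventually.of_forall fun _ => norm_nonneg _) hev hlim)

/-- Backward uniqueness for the memory variable: a history `η` with `η_t = -η_s - a`, `η(t, 0) = 0`
that vanishes at time `T` vanishes identically, and so does the source `a`. -/
theorem memory_eq_zero [CompleteSpace E] {G : Type*} [NormedAddCommGroup G] [NormedSpace ℝ G]
    [CompleteSpace G] (hc : ContinuousOn μ (Ici 0)) (hpos : ∀ s > 0, 0 < μ s)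
    (hanti : AntitoneOn μ (Ici 0)) (j : E →L[ℝ] G) (hj : Function.Injective j) {T : ℝ} (hT : 0 < T)
    {η : ℝ → Mem μ E} {a : ℝ → E} (hη : ContinuousOn η (Icc 0 T))
    (ha : ContinuousOn (fun t => j (a t)) (Icc 0 T))
    (h : ∀ t ∈ Icc 0 T, ∃ ζ : Mem μ E, MemGraph (∫ r in t..T, η r) ζ ∧
      (-η t : Mem μ E) =ᵐ[memMeasure μ] fun s => ζ s + a t) :
    ∀ t ∈ Icc 0 T, a t = 0 ∧ η t = 0 := by
  obtain ⟨Φ, hΦ, hΦc⟩ := Mem.exists_primitive (E := E) hc hpos hanti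
  have hac := volume_absolutelyContinuous_memMeasure hc hpos
  -- For `N t = ∫ r in t..T, η r` the graph relation says `∂_s N = η + a` with `N = 0` at `s = 0`;
  -- integration in `s` gives a representative that is continuous in `(t, s)` after applying `j`.
  have hrep (t : ℝ) (ht : t ∈ Icc 0 T) :
      (∫ r in t..T, η r : Mem μ E) =ᵐ[volume.restrict (Ioi 0)] fun s => Φ s (η t) + s • a t := by
    obtain ⟨ζ, ⟨hw, hz⟩, hae⟩ := h t ht
    have hint (x : Mem μ E) (s : ℝ) := Mem.integrableOn_Ioc hpos hanti x s
    refine (hw.ae_eq_primitive (fun s => (hint ζ s).neg) hz).trans ?_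
    filter_upwards [ae_restrict_mem measurableSet_Ioi] with s hs
    have hs0 : (0 : ℝ) ≤ s := le_of_lt hs
    rw [hΦ s hs0]
    have e1 : ∫ σ in (0 : ℝ)..s, -ζ σ = ∫ σ in (0 : ℝ)..s, (η t σ + a t) := by
      rw [intervalIntegral.integral_of_le hs0, intervalIntegral.integral_of_le hs0]
      refine integral_congr_ae (ae_restrict_of_ae_restrict_of_subset Ioc_subset_Ioi_self (hac ?_))
      filter_upwards [hae, Lp.coeFn_neg (η t)] with σ h1 h2
      rw [h2, Pi.neg_apply] at h1
      rw [eq_sub_of_add_eq h1.symm]; abel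
    refine Eq.trans e1 ?_
    rw [intervalIntegral.integral_add
      ((intervalIntegrable_iff_integrableOn_Ioc_of_le hs0).2 (hint _ _)) intervalIntegrable_const,
      intervalIntegral.integral_const, sub_zero]
  have hηi (t : ℝ) (ht : t ∈ Icc 0 T) : IntervalIntegrable η volume t T :=
    (hη.mono (Icc_subset_Icc_left ht.1)).intervalIntegrable_of_Icc ht.2
  -- Here `n` is `j` of the representative of `N t`. The integrated equation is the identity `Φ s (N
  -- t) = ∫ r in t..T, Φ s (η r)`, where `Φ s (η r)` is the representative of `N r` minus `s • a r`;
  -- hence the source `-j (a t)`.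
  have key := transport_eq_zero hT (n := fun t s => j (Φ s (η t)) + s • j (a t))
    (a := fun t => -j (a t)) ?_ ha.neg ?_
  · have hz : ∀ t ∈ Icc 0 T, a t = 0 := fun t ht =>
      hj (by rw [map_zero]; exact neg_eq_zero.1 (key t ht).1)
    have hN : ∀ t ∈ Icc 0 T, ∫ r in t..T, η r = 0 := by
      intro t ht
      refine Lp.eq_zero_iff_ae_eq_zero.2 (withDensity_absolutelyContinuous _ _ ?_)
      refine (hrep t ht).trans ?_
      filter_upwards [ae_restrict_mem measurableSet_Ioi] with s hs
      apply hj
      have := (key t ht).2 s (le_of_lt hs)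
      simpa using this
    have hη0 := eqOn_zero_of_integral_eq_zero hT hη hN
    exact fun t ht => ⟨hz t ht, hη0 t ht⟩
  · refine ContinuousOn.add ?_ (continuousOn_snd.smul (ha.comp continuousOn_fst fun q hq => hq.1))
    refine j.continuous.comp_continuousOn ?_
    exact hΦc.comp (f := fun q : ℝ × ℝ => (q.2, η q.1))
      (continuousOn_snd.prodMk (hη.comp continuousOn_fst fun q hq => hq.1))
      fun q hq => ⟨hq.2, mem_univ _⟩
  · intro t ht s hs
    have e1 : ∫ σ in (0 : ℝ)..s, (j (Φ σ (η t)) + σ • j (a t))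
        = j (Φ s (∫ r in t..T, η r)) := by
      rw [hΦ s hs, ← ContinuousLinearMap.intervalIntegral_comp_comm _
        ((intervalIntegrable_iff_integrableOn_Ioc_of_le hs).2
          (Mem.integrableOn_Ioc hpos hanti _ _)),
        intervalIntegral.integral_of_le hs, intervalIntegral.integral_of_le hs]
      refine integral_congr_ae ?_
      filter_upwards [ae_restrict_of_ae_restrict_of_subset Ioc_subset_Ioi_self (hrep t ht)]
        with σ hσ
      rw [hσ, map_add, map_smul]
    rw [e1, ← ContinuousLinearMap.intervalIntegral_comp_comm _ (hηi t ht),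
      ← ContinuousLinearMap.intervalIntegral_comp_comm _ ?_]
    · refine intervalIntegral.integral_congr fun r _ => ?_
      simp
    · exact ((Φ s).continuous.comp_continuousOn
        (hη.mono (Icc_subset_Icc_left ht.1))).intervalIntegrable_of_Icc ht.2

end MemorySpace

/-! ### Backward uniqueness for phase trajectories. -/

section BackwardUniqueness

theorem IsMildSolution.graph_integral_tail {X : Type*} [NormedAddCommGroup X] [NormedSpace ℝ X]
    [CompleteSpace X] {L : X → X → Prop} {g : ℝ → X → X}
    {T : ℝ} {U : ℝ → X} (hU : IsMildSolution L g T U) {t : ℝ} (ht : t ∈ Icc 0 T) :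
    L (∫ r in t..T, U r) (U T - U t - ∫ r in t..T, g r (U r)) := by
  have h1 := hU.graph_integral ht
  have h2 := hU.graph_integral (t := T) ⟨ht.1.trans ht.2, le_rfl⟩
  obtain ⟨S, -, hL, hc, hi, -⟩ := hU
  have h3 := hL.sub h2 h1
  have sub {a b : ℝ} (ha : 0 ≤ a) (hab : a ≤ b) (hb : b ≤ T) : Icc a b ⊆ Icc 0 T :=
    Icc_subset_Icc ha hb
  have iU {a b : ℝ} (ha : 0 ≤ a) (hab : a ≤ b) (hb : b ≤ T) : IntervalIntegrable U volume a b :=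
    (hc.mono (sub ha hab hb)).intervalIntegrable_of_Icc hab
  have ig {a b : ℝ} (ha : 0 ≤ a) (hab : a ≤ b) (hb : b ≤ T) :
      IntervalIntegrable (fun r => g r (U r)) volume a b :=
    (intervalIntegrable_iff_integrableOn_Icc_of_le hab).2 (hi.mono_set (sub ha hab hb))
  rw [← intervalIntegral.integral_add_adjacent_intervals (iU le_rfl ht.1 ht.2)
      (iU ht.1 ht.2 le_rfl),
    ← intervalIntegral.integral_add_adjacent_intervals (ig le_rfl ht.1 ht.2)
      (ig ht.1 ht.2 le_rfl)] at h3
  convert h3 using 1 <;> abel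

/-- No integrability is required: a non-integrable function has integral zero by convention. -/
theorem intervalIntegral_map_eq_zero {X Y : Type*} [NormedAddCommGroup X] [NormedSpace ℝ X]
    [CompleteSpace X] [NormedAddCommGroup Y] [NormedSpace ℝ Y] [CompleteSpace Y] (ℓ : X →L[ℝ] Y)
    {f : ℝ → X} (hf : ∀ r, ℓ (f r) = 0) (a b : ℝ) : ℓ (∫ r in a..b, f r) = 0 := by
  by_cases hi : IntervalIntegrable f volume a b
  · rw [← ContinuousLinearMap.intervalIntegral_comp_comm _ hi]; simp [hf]
  · rw [intervalIntegral.integral_undef hi, map_zero]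

variable {H : Type*} [NormedAddCommGroup H] [InnerProductSpace ℝ H]

theorem EigenOp.norm_val_le (A : EigenOp H) {s : ℝ≥0} (x : A.F s) :
    ‖A.val x‖ ≤ A.lam 0 ^ (-(s : ℝ)) * ‖x‖ := by
  have h2 : (0 : ℝ) < (2 : ℝ≥0∞).toReal := by norm_num
  rw [A.norm_eq, ← A.e.repr.norm_map (A.val x), ← A.e.repr.norm_map (A.pow s x)]
  have hc : 0 ≤ A.lam 0 ^ (-(s : ℝ)) := Real.rpow_nonneg A.lam_pos.le _
  refine lp.norm_le_of_forall_sum_le h2 (mul_nonneg hc (norm_nonneg _)) fun I => ?_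
  rw [Real.mul_rpow hc (norm_nonneg _)]
  refine le_trans ?_ (mul_le_mul_of_nonneg_left
    (lp.sum_rpow_le_norm_rpow h2 (A.e.repr (A.pow s x)) I) (Real.rpow_nonneg hc _))
  rw [Finset.mul_sum]
  refine Finset.sum_le_sum fun k _ => ?_
  rw [← Real.mul_rpow hc (norm_nonneg _)]
  refine Real.rpow_le_rpow (norm_nonneg _) ?_ h2.le
  rw [← A.coef_eq, ← A.coef_eq, A.coef_pow, norm_mul,
    Real.norm_of_nonneg (Real.rpow_nonneg (A.pos k).le _), ← mul_assoc]
  refine le_mul_of_one_le_left (norm_nonneg _) ?_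
  rw [Real.rpow_neg A.lam_pos.le, inv_mul_eq_div, one_le_div (Real.rpow_pos_of_pos A.lam_pos _)]
  exact Real.rpow_le_rpow A.lam_pos.le (A.lam_mono (Nat.zero_le k)) s.2

/-- The inclusion `F_s ⊆ H` as a continuous linear map. -/
def EigenOp.valL (A : EigenOp H) (s : ℝ≥0) : A.F s →L[ℝ] H :=
  (A.val (s := s)).mkContinuous (A.lam 0 ^ (-(s : ℝ))) A.norm_val_le

variable {A : EigenOp H} {μ₁ μ₂ : ℝ → ℝ} {β ω ν : ℝ}

/-- The two momentum equations are dropped; the rest suffices for backward uniqueness. -/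
theorem LinGraph.memory {X Y : Phase A μ₁ μ₂} (h : LinGraph β ω ν X Y) :
    A.val Y.1 = X.2.1 ∧
    (∃ ζ : Mem μ₁ (A.F 1), MemGraph X.2.2.2.1 ζ ∧
      Y.2.2.2.1 =ᵐ[memMeasure μ₁] fun s => ζ s + Y.1) ∧
    (∃ v : A.F (1 / 2), A.val v = X.2.2.1 ∧ ∃ ζ : Mem μ₂ (A.F (1 / 2)),
      MemGraph X.2.2.2.2 ζ ∧ Y.2.2.2.2 =ᵐ[memMeasure μ₂] fun s => ζ s + v) := by
  obtain ⟨u, w, v, ηb, η⟩ := X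
  obtain ⟨u', w', v', ηb', η'⟩ := Y
  exact ⟨h.1, h.2.2.2.1, h.2.2.2.2⟩

variable [CompleteSpace H]

/-- A continuous phase trajectory that vanishes at time `T` and solves the displacement and memory
equations in time-integrated form vanishes identically. -/
theorem phase_eq_zero (hc₁ : ContinuousOn μ₁ (Ici 0)) (hpos₁ : ∀ s > 0, 0 < μ₁ s)
    (hanti₁ : AntitoneOn μ₁ (Ici 0)) (hc₂ : ContinuousOn μ₂ (Ici 0)) (hpos₂ : ∀ s > 0, 0 < μ₂ s)
    (hanti₂ : AntitoneOn μ₂ (Ici 0)) {T : ℝ} (hT : 0 < T) {D : ℝ → Phase A μ₁ μ₂}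
    (hD : ContinuousOn D (Icc 0 T))
    -- `x` stands for the integrated forcing. The terminal condition is encoded by the absence of `D
    -- T` from `-D t - x`.
    (h : ∀ t ∈ Icc 0 T, ∃ x : Phase A μ₁ μ₂, x.1 = 0 ∧ x.2.2.2 = 0 ∧
      LinGraph β ω ν (∫ r in t..T, D r) (-D t - x)) :
    ∀ t ∈ Icc 0 T, D t = 0 := by
  have hcw : ContinuousOn (fun t => (D t).2.1) (Icc 0 T) := hD.snd.fst
  have hcv : ContinuousOn (fun t => (D t).2.2.1) (Icc 0 T) := hD.snd.snd.fst
  have hi (t : ℝ) (ht : t ∈ Icc 0 T) : IntervalIntegrable D volume t T :=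
    (hD.mono (Icc_subset_Icc_left ht.1)).intervalIntegrable_of_Icc ht.2
  have comp {Y : Type _} [NormedAddCommGroup Y] [NormedSpace ℝ Y] [CompleteSpace Y]
      (ℓ : Phase A μ₁ μ₂ →L[ℝ] Y) (t : ℝ) (ht : t ∈ Icc 0 T) :
      ℓ (∫ r in t..T, D r) = ∫ r in t..T, ℓ (D r) :=
    (ℓ.intervalIntegral_comp_comm (hi t ht)).symm
  let π₂ := ContinuousLinearMap.snd ℝ (A.F 1) (H × H × Mem μ₁ (A.F 1) × Mem μ₂ (A.F (1 / 2)))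
  let π₃ := (ContinuousLinearMap.snd ℝ H (H × Mem μ₁ (A.F 1) × Mem μ₂ (A.F (1 / 2)))).comp π₂
  let π₄ := (ContinuousLinearMap.snd ℝ H (Mem μ₁ (A.F 1) × Mem μ₂ (A.F (1 / 2)))).comp π₃
  have ew (t : ℝ) (ht : t ∈ Icc 0 T) : (∫ r in t..T, D r).2.1 = ∫ r in t..T, (D r).2.1 :=
    comp ((ContinuousLinearMap.fst ℝ _ _).comp π₂) t ht
  have ev (t : ℝ) (ht : t ∈ Icc 0 T) : (∫ r in t..T, D r).2.2.1 = ∫ r in t..T, (D r).2.2.1 :=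
    comp ((ContinuousLinearMap.fst ℝ _ _).comp π₃) t ht
  have eb (t : ℝ) (ht : t ∈ Icc 0 T) :
      (∫ r in t..T, D r).2.2.2.1 = ∫ r in t..T, (D r).2.2.2.1 :=
    comp ((ContinuousLinearMap.fst ℝ _ _).comp π₄) t ht
  have ee (t : ℝ) (ht : t ∈ Icc 0 T) :
      (∫ r in t..T, D r).2.2.2.2 = ∫ r in t..T, (D r).2.2.2.2 :=
    comp ((ContinuousLinearMap.snd ℝ _ _).comp π₄) t ht
  have hmem : ∀ t ∈ Icc 0 T, A.val (-(D t).1) = ∫ r in t..T, (D r).2.1 ∧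
      (∃ ζ : Mem μ₁ (A.F 1), MemGraph (∫ r in t..T, (D r).2.2.2.1) ζ ∧
        (-(D t).2.2.2.1 : Mem μ₁ (A.F 1)) =ᵐ[memMeasure μ₁] fun s => ζ s + -(D t).1) ∧
      (∃ v : A.F (1 / 2), A.val v = ∫ r in t..T, (D r).2.2.1 ∧ ∃ ζ : Mem μ₂ (A.F (1 / 2)),
        MemGraph (∫ r in t..T, (D r).2.2.2.2) ζ ∧
        (-(D t).2.2.2.2 : Mem μ₂ (A.F (1 / 2))) =ᵐ[memMeasure μ₂] fun s => ζ s + v) := by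
    intro t ht
    obtain ⟨x, hx1, hx2, hL⟩ := h t ht
    have hm := hL.memory
    rw [ew t ht, ev t ht, eb t ht, ee t ht] at hm
    have y1 : (-D t - x).1 = -(D t).1 := by simp [hx1]
    have y4 : (-D t - x).2.2.2.1 = -(D t).2.2.2.1 := by simp [hx2]
    have y5 : (-D t - x).2.2.2.2 = -(D t).2.2.2.2 := by simp [hx2]
    rw [y1, y4, y5] at hm
    exact hm
  have hub := memory_eq_zero hc₁ hpos₁ hanti₁ (ContinuousLinearMap.id ℝ (A.F 1))
    Function.injective_id hT (η := fun t => (D t).2.2.2.1) (a := fun t => -(D t).1)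
    hD.snd.snd.snd.fst hD.fst.neg fun t ht => (hmem t ht).2.1
  have hw0 : ∀ t ∈ Icc 0 T, (D t).2.1 = 0 := by
    refine eqOn_zero_of_integral_eq_zero hT hcw fun t ht => ?_
    rw [← (hmem t ht).1, (hub t ht).1, map_zero]
  choose! v hv ζ hζ using fun t ht => (hmem t ht).2.2
  -- `v t` is the time integral of an `H`-valued function, so its continuity is known in `H` but not
  -- in `F_{1/2}`. For this reason `memory_eq_zero` asks for continuity only after an injective map
  -- `j`.
  have hvc : ContinuousOn (fun t => A.valL (1 / 2) (v t)) (Icc 0 T) := by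
    have h1 : ContinuousOn (fun t => ∫ r in t..T, (D r).2.2.1) (Icc 0 T) := by
      have := intervalIntegral.continuousOn_primitive_interval_left (μ := volume)
        (f := fun r => (D r).2.2.1) (a := 0) (b := T) (by
          rw [uIcc_of_le hT.le]; exact hcv.integrableOn_Icc)
      rwa [uIcc_of_le hT.le] at this
    exact h1.congr fun t ht => hv t ht
  have hve := memory_eq_zero hc₂ hpos₂ hanti₂ (A.valL (1 / 2)) A.val_injective hT
    (η := fun t => (D t).2.2.2.2) (a := v) hD.snd.snd.snd.snd hvc
    fun t ht => ⟨ζ t, hζ t ht⟩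
  have hv0 : ∀ t ∈ Icc 0 T, (D t).2.2.1 = 0 := by
    refine eqOn_zero_of_integral_eq_zero hT hcv fun t ht => ?_
    rw [← hv t ht, (hve t ht).1, map_zero]
  exact fun t ht => Prod.ext (neg_eq_zero.1 (hub t ht).1) (Prod.ext (hw0 t ht)
    (Prod.ext (hv0 t ht) (Prod.ext (hub t ht).2 (hve t ht).2)))

theorem integral_velocity_source {g : ℝ → Phase A μ₁ μ₂} (h1 : ∀ r, (g r).1 = 0)
    (h2 : ∀ r, (g r).2.2 = 0) (a b : ℝ) :
    (∫ r in a..b, g r).1 = 0 ∧ (∫ r in a..b, g r).2.2.2 = 0 := by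
  refine ⟨intervalIntegral_map_eq_zero (ContinuousLinearMap.fst ℝ (A.F 1)
    (H × H × Mem μ₁ (A.F 1) × Mem μ₂ (A.F (1 / 2)))) h1 a b, ?_⟩
  have := intervalIntegral_map_eq_zero ((ContinuousLinearMap.snd ℝ H
    (H × Mem μ₁ (A.F 1) × Mem μ₂ (A.F (1 / 2)))).comp (ContinuousLinearMap.snd ℝ (A.F 1) _))
    h2 a b
  exact congrArg Prod.snd this

end BackwardUniqueness

end

/-- Backward uniqueness for the abstract plate model with memory and for its linearization. -/
theorem proposition2p11
    {H : Type*} [NormedAddCommGroup H] [InnerProductSpace ℝ H] [CompleteSpace H]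
    (A : EigenOp H)
    (k₁ k₂ μ₁ μ₂ : ℝ → ℝ) (δ₁ δ₂ β ω ν : ℝ) (p : H) (M : ℝ → ℝ)
    (hω : ω ∈ Ico (0 : ℝ) 1) (hν : 0 < ν)
    (hk₁ : IsMemoryKernel 1 k₁ μ₁ δ₁) (hk₂ : IsMemoryKernel (1 - ω) k₂ μ₂ δ₂)
    (hβ : 0 < β) (hk₁_lim : Tendsto k₁ atTop (𝓝 β)) (hk₂_lim : Tendsto k₂ atTop (𝓝 0))
    (hM : IsAdmissibleM (A.lam 0) M)
    (T : ℝ) (hT : 0 < T) :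
    (∀ U₁ U₂ : ℝ → Phase A μ₁ μ₂,
      IsMildSolution (LinGraph β ω ν) (fun _ U => force M p U) T U₁ →
      IsMildSolution (LinGraph β ω ν) (fun _ U => force M p U) T U₂ →
      U₁ T = U₂ T → ∀ t ∈ Icc 0 T, U₁ t = U₂ t) ∧
    (∀ (u : ℝ → A.F 1) (W : ℝ → Phase A μ₁ μ₂),
      ContinuousOn u (Icc 0 T) →
      IsMildSolution (LinGraph β ω ν) (fun t W => forceDeriv M (u t) W) T W →
      W T = 0 → ∀ t ∈ Icc 0 T, W t = 0) := by
  have hpos₁ : ∀ s > 0, 0 < μ₁ s := fun s hs => hk₁.pos one_pos hs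
  have hpos₂ : ∀ s > 0, 0 < μ₂ s := fun s hs => hk₂.pos (sub_pos.2 hω.2) hs
  constructor
  · intro U₁ U₂ hU₁ hU₂ hend t ht
    have hc₁ := hU₁.choose_spec.2.2.1
    have hc₂ := hU₂.choose_spec.2.2.1
    have key := phase_eq_zero (A := A) (β := β) (ω := ω) (ν := ν) hk₁.continuousOn hpos₁
      hk₁.antitoneOn hk₂.continuousOn hpos₂ hk₂.antitoneOn hT (D := fun t => U₁ t - U₂ t)
      (hc₁.sub hc₂) fun t ht => ?_
    · exact sub_eq_zero.1 (key t ht)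
    obtain ⟨a1, a2⟩ := integral_velocity_source (g := fun r => force M p (U₁ r))
      (fun _ => rfl) (fun _ => rfl) t T
    obtain ⟨b1, b2⟩ := integral_velocity_source (g := fun r => force M p (U₂ r))
      (fun _ => rfl) (fun _ => rfl) t T
    refine ⟨(∫ r in t..T, force M p (U₁ r)) - ∫ r in t..T, force M p (U₂ r),
      by simp [a1, b1], by simp [a2, b2], ?_⟩
    -- The two solutions may come with different semigroups; both graph relations concern the same
    -- `LinGraph`, so either semigroup justifies the subtraction.
    have h1 := hU₁.choose_spec.2.1.sub (hU₁.graph_integral_tail ht) (hU₂.graph_integral_tail ht)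
    have hsub := Icc_subset_Icc_left (b := T) ht.1
    rw [intervalIntegral.integral_sub ((hc₁.mono hsub).intervalIntegrable_of_Icc ht.2)
      ((hc₂.mono hsub).intervalIntegrable_of_Icc ht.2)]
    convert h1 using 1
    rw [hend]
    abel
  · intro u W _ hW hend
    refine phase_eq_zero (A := A) (β := β) (ω := ω) (ν := ν) hk₁.continuousOn hpos₁
      hk₁.antitoneOn hk₂.continuousOn hpos₂ hk₂.antitoneOn hT hW.choose_spec.2.2.1
      fun t ht => ?_
    obtain ⟨a1, a2⟩ := integral_velocity_source (g := fun r => forceDeriv M (u r) (W r))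
      (fun _ => rfl) (fun _ => rfl) t T
    refine ⟨∫ r in t..T, forceDeriv M (u r) (W r), a1, a2, ?_⟩
    have h1 := hW.graph_integral_tail ht
    rwa [hend, zero_sub] at h1
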